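/- Throughout, $\log=\log_2$, graphs are finite and simple, $n$ is a positive integer, and $G_{n,p}$ is the Erdős–Rényi random graph on the vertex set $\{1,\dots,n\}$ in which each edge of $K_n$ is present independently with probability $p$. A copy of a graph $J$ in a graph $G$ is a (not necessarily induced, unlabeled) subgraph of $G$ isomorphic to $J$; $N(G,J)$ is the number of such copies, and $\mathbb{E}_pX_J=\mathbb{E}\,N(G_{n,p},J)$. For a graph $H$ with at most $n$ vertices, the graphic expectation threshold and the fractional expectation threshold of $H$ are $$p_E(H)=p_E(n,H)=\min\{p\in[0,1]:\ \mathbb{E}_pX_I\ge 1/2\ \text{ for all } I\subseteq H\},$$ $$p_E^*(H)=p_E^*(n,H)=\min\{p\in[0,1]:\ \mathbb{E}_pX_I\ge N(H,I)/2\ \text{ for all } I\subseteq H\}.$$ **Theorem.** There is a universal constant $K$ such that for every $n$ and every graph $H$ with at least one edge and at most $n$ vertices, $$p_E^*(H)<K\,p_E(H)\log^2 n.$$ Furthermore, there is a universal constant $\alpha>0$ such that for every $n$ and every graph $H$ with at least one edge and at most $n$ vertices, if $p_E(H)<1/(3n)$, then $p_E^*(H)<\alpha^{-1}p_E(H)$.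 -/

import Mathlib

open MeasureTheory unitInterval
open scoped SimpleGraph

universe u

/-- `expCopies n p J` is the expected number of (unlabeled, not necessarily induced) copies of the
graph `J` in the binomial random graph `G(n, p)` on the vertex set `Fin n`. -/
noncomputable def expCopies {W : Type*} (n : ℕ) (p : I) (J : SimpleGraph W) : ℝ :=
  ∫ G : SimpleGraph (Fin n), (G.copyCount J : ℝ) ∂(SimpleGraph.binomialRandom (Fin n) p)

/-- The probabilities `p ∈ [0, 1]` at which every subgraph of `H` has at least `1 / 2` expected
copies in `G(n, p)`. -/
def graphicFeasible {V : Type*} (n : ℕ) (H : SimpleGraph V) : Set I :=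
  {p | ∀ J : H.Subgraph, 1 / 2 ≤ expCopies n p J.coe}

/-- The probabilities `p ∈ [0, 1]` at which, for every subgraph `J` of `H`, the expected number of
copies of `J` in `G(n, p)` is at least half of the number of copies of `J` in `H`. -/
def fractionalFeasible {V : Type*} [Fintype V] (n : ℕ) (H : SimpleGraph V) : Set I :=
  {p | ∀ J : H.Subgraph, (H.copyCount J.coe : ℝ) / 2 ≤ expCopies n p J.coe}

/-- The graphic expectation threshold of `H` with respect to `G(n, p)`. The infimum is a minimum as soon as `H` has at most
`n` vertices, see `isLeast_graphicThreshold`. -/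
noncomputable def graphicThreshold {V : Type*} (n : ℕ) (H : SimpleGraph V) : I :=
  sInf (graphicFeasible n H)

/-- The fractional expectation threshold of `H` with respect to `G(n, p)`. The infimum is a minimum as soon as `H` has at most
`n` vertices, see `isLeast_fractionalThreshold`. -/
noncomputable def fractionalThreshold {V : Type*} [Fintype V] (n : ℕ) (H : SimpleGraph V) : I :=
  sInf (fractionalFeasible n H)

theorem measurableSingletonClass_simpleGraph (n : ℕ) :
    MeasurableSingletonClass (SimpleGraph (Fin n)) := by
  refine ⟨fun G => ?_⟩
  have h : ({G} : Set (SimpleGraph (Fin n))) = SimpleGraph.edgeSet ⁻¹' {G.edgeSet} := by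
    ext G'; simp
  rw [h]
  exact SimpleGraph.measurableEmbedding_edgeSet.measurable (measurableSet_singleton _)

theorem expCopies_eq_sum {W : Type*} (n : ℕ) (p : I) (J : SimpleGraph W) :
    expCopies n p J = ∑ G : SimpleGraph (Fin n),
      ((p : ℝ) ^ G.edgeSet.ncard * (1 - p : ℝ) ^ (n.choose 2 - G.edgeSet.ncard)) *
        (G.copyCount J : ℝ) := by
  have := measurableSingletonClass_simpleGraph n
  rw [expCopies, integral_fintype (.of_finite)]
  simp [measureReal_def]

theorem continuous_expCopies {W : Type*} (n : ℕ) (J : SimpleGraph W) :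
    Continuous fun p : I => expCopies n p J := by
  simp only [expCopies_eq_sum]
  fun_prop

theorem expCopies_one {W : Type*} (n : ℕ) (J : SimpleGraph W) :
    expCopies n 1 J = ((⊤ : SimpleGraph (Fin n)).copyCount J : ℝ) := by
  have := measurableSingletonClass_simpleGraph n
  simp [expCopies]

theorem copyCount_le_of_isContained {V V' W : Type*} [Fintype V] [Fintype V'] {H : SimpleGraph V}
    {G : SimpleGraph V'} (f : H.Copy G) (J : SimpleGraph W) :
    H.copyCount J ≤ G.copyCount J := by
  classical
  rw [SimpleGraph.copyCount, SimpleGraph.copyCount]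
  refine Finset.card_le_card_of_injOn (fun H' => H'.map f.toHom) ?_ ?_
  · intro H' hH'
    simp only [Finset.coe_filter, Finset.mem_univ, true_and, Set.mem_ofPred_eq] at hH' ⊢
    exact hH'.map fun e => (f.isoSubgraphMap H').comp e
  · have hl : Function.LeftInverse (SimpleGraph.Subgraph.comap f.toHom)
        (SimpleGraph.Subgraph.map f.toHom) := by
      intro H'
      ext a b
      · have h := fun x => f.injective.eq_iff (a := x) (b := a)
        simp only [SimpleGraph.Copy.coe_toHom] at h
        simp [h]
      · have := fun h : H'.Adj a b => h.adj_sub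
        simp only [SimpleGraph.Subgraph.comap_adj, SimpleGraph.Subgraph.map_adj,
          Relation.map_apply, f.injective.eq_iff]
        grind
    exact hl.injective.injOn

theorem isLeast_graphicThreshold {V : Type*} [Fintype V] (n : ℕ) (H : SimpleGraph V)
    (hn : Fintype.card V ≤ n) : IsLeast (graphicFeasible n H) (graphicThreshold n H) := by
  refine IsCompact.isLeast_sInf (IsClosed.isCompact ?_) ⟨1, fun J => ?_⟩
  · simp only [graphicFeasible, Set.ofPred_forall]
    exact isClosed_iInter fun J => isClosed_le continuous_const (continuous_expCopies n _)
  · rw [expCopies_one]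
    have h : J.coe ⊑ (⊤ : SimpleGraph (Fin n)) :=
      J.coe_isContained.trans (SimpleGraph.isContained_top_iff.2
        (Function.Embedding.nonempty_of_card_le (by simpa using hn)))
    have h1 : 0 < (⊤ : SimpleGraph (Fin n)).copyCount J.coe := SimpleGraph.copyCount_pos.2 h
    have : (1 : ℝ) ≤ (⊤ : SimpleGraph (Fin n)).copyCount J.coe := by exact_mod_cast h1
    linarith

theorem isLeast_fractionalThreshold {V : Type*} [Fintype V] (n : ℕ) (H : SimpleGraph V)
    (hn : Fintype.card V ≤ n) : IsLeast (fractionalFeasible n H) (fractionalThreshold n H) := by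
  refine IsCompact.isLeast_sInf (IsClosed.isCompact ?_) ⟨1, fun J => ?_⟩
  · simp only [fractionalFeasible, Set.ofPred_forall]
    exact isClosed_iInter fun J => isClosed_le continuous_const (continuous_expCopies n _)
  · rw [expCopies_one]
    obtain ⟨f⟩ : H ⊑ (⊤ : SimpleGraph (Fin n)) := SimpleGraph.isContained_top_iff.2
      (Function.Embedding.nonempty_of_card_le (by simpa using hn))
    have h : (H.copyCount J.coe : ℝ) ≤ (⊤ : SimpleGraph (Fin n)).copyCount J.coe := by
      exact_mod_cast copyCount_le_of_isContained f J.coe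
    have : (0 : ℝ) ≤ H.copyCount J.coe := by positivity
    linarith

/-! Write `(n)_v` for the falling factorial, and let `J` have `v` vertices and `e` edges. Then
`expCopies n p J` equals `(n)_v p^e / aut J`, while the number of copies of `J` in `H` is the number
of injective homomorphisms `J → H` divided by `aut J`. Feasibility of `p` for the graphic threshold
thus says `aut J ≤ 2 (n)_v p^e` for all `J ⊆ H` (`IsSparse`). For the fractional threshold to be at
most `q`, it suffices that every `J ⊆ H` has at most `(n)_v q^e` injective homomorphisms into `H`.
Both bounds therefore ask how a bound on automorphisms controls embeddings. The main tool is the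
sunflower: `t` copies of one pattern in `H`, disjoint outside a common kernel, form a subgraph with
at least `t!` automorphisms, so `t` cannot be large (`IsSparse.factorial_mul_pow_le`).

For the `log²` bound, round `p` up to `2^{-b}` and take `2^a` of order `n`. Sparsity gives `b e(P) ≤
a v(P)` for all `P ⊆ H`, and Hall's theorem turns this into an orientation of `H` with out-degrees
at most `a = O(log n)` (`IsSparse.exists_orientation`). Fix the orientation pattern pulled back to
`F`, at a cost of `4^e`, and embed `F` one strongly connected piece `C` at a time, each piece having
its out-arcs only into itself and earlier pieces. One vertex of `C` determines the rest up to
`a^{|C|-1}` choices, so many extensions contain many disjoint ones, which form a sunflower. This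
gives about `p^k (O(a) n)^{|C|}` extensions, up to a factor `2^k`, where `k` is the number of new
edges (`IsSparse.card_extensions_le`). Multiplying over the pieces leaves an excess `O(a)^v`.
Without isolated vertices `v ≤ 2e`, so the excess is absorbed into `(O(a²) p)^e`.

If `np ≤ 1/3`, sparsity makes every connected subgraph of `H` a tree. Sunflowers with empty kernel
bound how many components are isomorphic to a given tree. Counting pairs of a labelled tree and a
copy of `F` in it by parent functions gives `O(n) (e n p)^{v-1}` copies of a connected `F` in
components of size `v`, where here `e` is Euler's number. As `e/3 < 1` the sum over `v` is
geometric, and no logarithm is lost. -/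

namespace SimpleGraph

variable {V W : Type*}

/-! ### Copies, automorphisms and the expected number of copies -/

instance Copy.instFinite [Finite V] [Finite W] (J : SimpleGraph W) (G : SimpleGraph V) :
    Finite (J.Copy G) :=
  Finite.of_injective (fun f : J.Copy G => (f : W → V)) DFunLike.coe_injective

instance Iso.instFinite [Finite V] [Finite W] (J : SimpleGraph W) (G : SimpleGraph V) :
    Finite (J ≃g G) :=
  Finite.of_injective (fun f : J ≃g G => (f : W → V)) DFunLike.coe_injective

theorem Copy.adj {J : SimpleGraph W} {G : SimpleGraph V} (f : J.Copy G) {a b : W}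
    (h : J.Adj a b) : G.Adj (f a) (f b) := f.toHom.map_adj h

theorem Copy.inj {J : SimpleGraph W} {G : SimpleGraph V} (f : J.Copy G) {a b : W}
    (h : f a = f b) : a = b := f.injective h

theorem card_iso_eq_of_iso [Finite V] [Finite W] {J : SimpleGraph W} {G : SimpleGraph V}
    (e : J ≃g G) : Nat.card (J ≃g G) = Nat.card (J ≃g J) :=
  Nat.card_congr
    { toFun := fun f => f.trans e.symm
      invFun := fun f => f.trans e
      left_inv := fun f => by ext; simp
      right_inv := fun f => by ext; simp }

theorem card_aut_congr [Finite V] [Finite W] {J : SimpleGraph W} {G : SimpleGraph V}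
    (e : J ≃g G) : Nat.card (G ≃g G) = Nat.card (J ≃g J) :=
  Nat.card_congr
    { toFun := fun f => (e.trans f).trans e.symm
      invFun := fun f => (e.symm.trans f).trans e
      left_inv := fun f => by ext; simp
      right_inv := fun f => by ext; simp }

theorem card_aut_pos [Finite W] (J : SimpleGraph W) : 0 < Nat.card (J ≃g J) :=
  have : Nonempty (J ≃g J) := ⟨Iso.refl⟩
  Nat.card_pos

/-- An injective homomorphism is the same as its image subgraph together with an isomorphism onto
that image. -/
theorem card_copy_eq_copyCount_mul [Fintype V] [Finite W] (J : SimpleGraph W)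
    (G : SimpleGraph V) : Nat.card (J.Copy G) = G.copyCount J * Nat.card (J ≃g J) := by
  classical
  let g : (Σ S : {S : G.Subgraph // Nonempty (J ≃g S.coe)}, J ≃g S.1.coe) → J.Copy G :=
    fun x => x.1.1.coeCopy.comp x.2.toCopy
  have hg : Function.Bijective g := by
    constructor
    · rintro ⟨⟨S, hS⟩, e⟩ ⟨⟨S', hS'⟩, e'⟩ h
      have hv : ∀ w, (e w : V) = (e' w : V) := fun w => DFunLike.congr_fun h w
      have hSS : S = S' := by
        ext a b
        · constructor
          · intro ha
            have := hv (e.symm ⟨a, ha⟩)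
            simp only [RelIso.apply_symm_apply] at this
            rw [this]; exact Subtype.coe_prop _
          · intro ha
            have := hv (e'.symm ⟨a, ha⟩)
            simp only [RelIso.apply_symm_apply] at this
            rw [← this]; exact Subtype.coe_prop _
        · constructor
          · intro hab
            have h1 : J.Adj (e.symm ⟨a, hab.fst_mem⟩) (e.symm ⟨b, hab.snd_mem⟩) := by
              rw [e.symm.map_adj_iff]; exact hab
            have h2 := e'.map_adj_iff.2 h1
            rw [Subgraph.coe_adj, ← hv, ← hv] at h2
            simpa using h2
          · intro hab
            have h1 : J.Adj (e'.symm ⟨a, hab.fst_mem⟩) (e'.symm ⟨b, hab.snd_mem⟩) := by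
              rw [e'.symm.map_adj_iff]; exact hab
            have h2 := e.map_adj_iff.2 h1
            rw [Subgraph.coe_adj, hv, hv] at h2
            simpa using h2
      subst hSS
      have : e = e' := by ext w; exact hv w
      rw [this]
    · intro f
      refine ⟨⟨⟨f.toSubgraph, ⟨f.isoToSubgraph⟩⟩, f.isoToSubgraph⟩, ?_⟩
      ext w
      rfl
  rw [← Nat.card_eq_of_bijective g hg, Nat.card_sigma]
  have h1 : ∀ S : {S : G.Subgraph // Nonempty (J ≃g S.coe)},
      Nat.card (J ≃g S.1.coe) = Nat.card (J ≃g J) := fun S => card_iso_eq_of_iso S.2.some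
  simp only [h1, Finset.sum_const, Finset.card_univ, smul_eq_mul]
  rw [copyCount, Fintype.card_subtype]

/-- This is the probability that the random graph contains `S`: the edges outside `S` are free, and
their weights sum to `(p + (1 - p))^|A| = 1`. -/
theorem sum_binomial_weight_of_le (n : ℕ) (p : ℝ) (S : SimpleGraph (Fin n))
    [DecidablePred fun G : SimpleGraph (Fin n) => S ≤ G] :
    ∑ G : SimpleGraph (Fin n) with S ≤ G,
      (p ^ G.edgeSet.ncard * (1 - p) ^ (n.choose 2 - G.edgeSet.ncard)) =
      p ^ S.edgeSet.ncard := by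
  classical
  have hc : ∀ G : SimpleGraph (Fin n), G.edgeSet.ncard = G.edgeFinset.card := fun G => by
    rw [← coe_edgeFinset, Set.ncard_coe_finset]
  have htop : n.choose 2 = (⊤ : SimpleGraph (Fin n)).edgeFinset.card := by
    rw [card_edgeFinset_top_eq_card_choose_two, Fintype.card_fin]
  set A := (⊤ : SimpleGraph (Fin n)).edgeFinset \ S.edgeFinset with hA
  have hsub : ∀ G : SimpleGraph (Fin n), G.edgeFinset ⊆ (⊤ : SimpleGraph (Fin n)).edgeFinset :=
    fun G => edgeFinset_subset_edgeFinset.2 le_top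
  have hcA : A.card = n.choose 2 - S.edgeFinset.card := by
    rw [hA, Finset.card_sdiff_of_subset (hsub S), htop]
  have key := Finset.sum_pow_mul_eq_add_pow p (1 - p) A
  rw [add_sub_cancel, one_pow] at key
  have : p ^ S.edgeSet.ncard = p ^ S.edgeSet.ncard *
      ∑ t ∈ A.powerset, p ^ t.card * (1 - p) ^ (A.card - t.card) := by rw [key, mul_one]
  rw [this, Finset.mul_sum]
  refine Finset.sum_bij' (fun G _ => G.edgeFinset \ S.edgeFinset)
    (fun t _ => fromEdgeSet (↑t ∪ S.edgeSet)) ?_ ?_ ?_ ?_ ?_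
  · intro G hG
    exact Finset.mem_powerset.2 (Finset.sdiff_subset_sdiff (hsub G) le_rfl)
  · intro t ht
    simp only [Finset.mem_filter, Finset.mem_univ, true_and]
    intro a b hab
    simp [hab, hab.ne]
  · intro G hG
    simp only [Finset.mem_filter, Finset.mem_univ, true_and] at hG
    ext a b
    have := @hG a b
    simp only [Finset.coe_sdiff, coe_edgeFinset, fromEdgeSet_adj, Set.mem_union, Set.mem_sdiff,
      mem_edgeSet]
    have h2 := fun h : G.Adj a b => h.ne
    tauto
  · intro t ht
    rw [Finset.mem_powerset] at ht
    ext e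
    have h1 : e ∈ t → e ∈ (⊤ : SimpleGraph (Fin n)).edgeSet ∧ e ∉ S.edgeSet := fun h => by
      simpa [hA] using ht h
    induction e with | _ a b
    simp only [Finset.mem_sdiff, mem_edgeFinset, edgeSet_fromEdgeSet] at h1 ⊢
    simp only [Set.mem_sdiff, Set.mem_union, Finset.mem_coe, mem_edgeSet, top_adj] at h1 ⊢
    simp only [Sym2.mem_diagSet, Sym2.mk_isDiag_iff]
    tauto
  · intro G hG
    simp only [Finset.mem_filter, Finset.mem_univ, true_and] at hG
    have h1 : S.edgeFinset ⊆ G.edgeFinset := edgeFinset_subset_edgeFinset.2 hG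
    rw [Finset.card_sdiff_of_subset h1, hcA, hc, hc, ← mul_assoc, ← pow_add]
    have h2 := Finset.card_le_card h1
    have h3 := Finset.card_le_card (hsub G)
    congr 2 <;> omega

theorem card_copy_eq_card_filter [Finite V] [Finite W] (J : SimpleGraph W) (G : SimpleGraph V) :
    Nat.card (J.Copy G) = Nat.card {f : W ↪ V // J.map f ≤ G} :=
  Nat.card_congr
    { toFun := fun f => ⟨f.toEmbedding, by
        rintro _ _ ⟨_, a, b, h, rfl, rfl⟩; exact f.adj h⟩
      invFun := fun f => ⟨⟨f.1, fun {a b} h => f.2 ((map_adj_apply).2 h)⟩, f.1.injective⟩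
      left_inv := fun f => rfl
      right_inv := fun f => rfl }

theorem ncard_edgeSet_map (J : SimpleGraph W) (f : W ↪ V) :
    (J.map f).edgeSet.ncard = J.edgeSet.ncard := by
  rw [edgeSet_map, Set.ncard_image_of_injective _ f.sym2Map.injective]

/-- Linearity of expectation over injections of `W` into `Fin n`; the automorphism factor converts
unlabelled copies to injections. -/
theorem card_aut_mul_expCopies [Finite W] (n : ℕ) (p : I) (J : SimpleGraph W) :
    (Nat.card (J ≃g J) : ℝ) * expCopies n p J =
      n.descFactorial (Nat.card W) * (p : ℝ) ^ J.edgeSet.ncard := by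
  classical
  have := Fintype.ofFinite W
  rw [expCopies_eq_sum, Finset.mul_sum]
  have h1 : ∀ G : SimpleGraph (Fin n),
      (Nat.card (J ≃g J) : ℝ) * (((p : ℝ) ^ G.edgeSet.ncard *
        (1 - p : ℝ) ^ (n.choose 2 - G.edgeSet.ncard)) * (G.copyCount J : ℝ)) =
      ∑ f : W ↪ Fin n, if J.map f ≤ G then ((p : ℝ) ^ G.edgeSet.ncard *
        (1 - p : ℝ) ^ (n.choose 2 - G.edgeSet.ncard)) else 0 := by
    intro G
    rw [← Finset.sum_filter, Finset.sum_const, nsmul_eq_mul, ← Fintype.card_subtype,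
      ← Nat.card_eq_fintype_card, ← card_copy_eq_card_filter, card_copy_eq_copyCount_mul]
    push_cast
    ring
  simp only [h1]
  rw [Finset.sum_comm]
  simp only [← Finset.sum_filter, sum_binomial_weight_of_le, ncard_edgeSet_map, Finset.sum_const,
    Finset.card_univ, nsmul_eq_mul]
  rw [Fintype.card_embedding_eq, Fintype.card_fin, Nat.card_eq_fintype_card]

/-! ### Sparsity as a bound on automorphisms -/

/-- Every subgraph of `H` has at least `1 / 2` expected copies in `G(n, p)`, written as a bound on
automorphism counts. -/
def IsSparse (n : ℕ) (p : ℝ) (H : SimpleGraph V) : Prop :=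
  ∀ J : H.Subgraph, (Nat.card (J.coe ≃g J.coe) : ℝ) / 2 ≤
    n.descFactorial (Nat.card J.verts) * p ^ J.coe.edgeSet.ncard

theorem isSparse_of_mem_graphicFeasible [Finite V] {n : ℕ} {p : I} {H : SimpleGraph V}
    (hp : p ∈ graphicFeasible n H) : IsSparse n p H := by
  intro J
  rw [← card_aut_mul_expCopies]
  have h1 := hp J
  have h2 : (0 : ℝ) ≤ Nat.card (J.coe ≃g J.coe) := by positivity
  nlinarith

theorem mem_fractionalFeasible_of_card_copy_le [Fintype V] {n : ℕ} {q : I} {H : SimpleGraph V}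
    (h : ∀ J : H.Subgraph, (Nat.card (J.coe.Copy H) : ℝ) ≤
      n.descFactorial (Nat.card J.verts) * (q : ℝ) ^ J.coe.edgeSet.ncard) :
    q ∈ fractionalFeasible n H := by
  intro J
  have h1 := h J
  rw [← card_aut_mul_expCopies, card_copy_eq_copyCount_mul, Nat.cast_mul, mul_comm] at h1
  have h2 : (0 : ℝ) < Nat.card (J.coe ≃g J.coe) := by exact_mod_cast card_aut_pos _
  have h3 := le_of_mul_le_mul_left h1 h2
  have h4 : (0 : ℝ) ≤ H.copyCount J.coe := by positivity
  linarith

theorem IsSparse.mono {n : ℕ} {p q : ℝ} {H : SimpleGraph V} (hs : IsSparse n p H) (hp : 0 ≤ p)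
    (hpq : p ≤ q) : IsSparse n q H := fun J =>
  (hs J).trans (by gcongr)

theorem IsSparse.card_aut_le [Finite W] {n : ℕ} {p : ℝ} {H : SimpleGraph V}
    (hs : IsSparse n p H) (hp : 0 ≤ p) {P : SimpleGraph W} (f : P.Copy H) :
    (Nat.card (P ≃g P) : ℝ) ≤ 2 * ((n : ℝ) ^ Nat.card W * p ^ P.edgeSet.ncard) := by
  have e := f.isoToSubgraph
  have : Finite f.toSubgraph.verts := .of_equiv _ e.toEquiv
  have h := hs f.toSubgraph
  have h1 : f.toSubgraph.coe.edgeSet.ncard = P.edgeSet.ncard := by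
    rw [← Nat.card_coe_set_eq, ← Nat.card_coe_set_eq]
    exact (Nat.card_congr e.mapEdgeSet).symm
  have h2 : Nat.card f.toSubgraph.verts = Nat.card W := (Nat.card_congr e.toEquiv).symm
  rw [card_aut_congr e, h1, h2] at h
  have h3 : (n.descFactorial (Nat.card W) : ℝ) ≤ (n : ℝ) ^ Nat.card W := by
    exact_mod_cast Nat.descFactorial_le_pow _ _
  have h4 : (n.descFactorial (Nat.card W) : ℝ) * p ^ P.edgeSet.ncard ≤
      (n : ℝ) ^ Nat.card W * p ^ P.edgeSet.ncard := by gcongr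
  linarith

theorem IsSparse.one_le [Finite W] {n : ℕ} {p : ℝ} {H : SimpleGraph V}
    (hs : IsSparse n p H) (hp : 0 ≤ p) {P : SimpleGraph W} (f : P.Copy H) :
    1 ≤ 2 * ((n : ℝ) ^ Nat.card W * p ^ P.edgeSet.ncard) :=
  le_trans (by exact_mod_cast card_aut_pos P) (hs.card_aut_le hp f)

/-! ### Sunflowers -/

section Sunflower

variable {R C : Type*}

/-- The inclusion of the pattern `R ⊕ C` as the petal with index `i` of a sunflower. -/
def petal (R C : Type*) {t : ℕ} (i : Fin t) : R ⊕ C ↪ R ⊕ Fin t × C :=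
  (Function.Embedding.refl R).sumMap ⟨Prod.mk i, Prod.mk_right_injective i⟩

@[simp] theorem petal_inl {t : ℕ} (i : Fin t) (r : R) : petal R C i (.inl r) = .inl r := rfl
@[simp] theorem petal_inr {t : ℕ} (i : Fin t) (c : C) : petal R C i (.inr c) = .inr (i, c) := rfl

/-- The union of `t` copies of the graph `Q` glued along the kernel `R`. -/
def sunflower (Q : SimpleGraph (R ⊕ C)) (t : ℕ) : SimpleGraph (R ⊕ Fin t × C) :=
  ⨆ i, Q.map (petal R C i)

theorem sunflower_adj {Q : SimpleGraph (R ⊕ C)} {t : ℕ} {x y : R ⊕ Fin t × C} :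
    (sunflower Q t).Adj x y ↔
      ∃ i a b, Q.Adj a b ∧ petal R C i a = x ∧ petal R C i b = y := by
  simp only [sunflower, iSup_adj, map_adj]

/-- By `hQ` every edge of `Q` has an endpoint outside the kernel, and the image of that endpoint
reveals the index of the petal. Hence distinct petals share no edge. -/
theorem card_mul_ncard_edgeSet_le_sunflower [Finite R] [Finite C] (Q : SimpleGraph (R ⊕ C))
    (hQ : ∀ r r', ¬ Q.Adj (.inl r) (.inl r')) (t : ℕ) :
    t * Q.edgeSet.ncard ≤ (sunflower Q t).edgeSet.ncard := by
  let g : Fin t × Q.edgeSet → (sunflower Q t).edgeSet := fun x =>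
    ⟨Sym2.map (petal R C x.1) x.2.1, by
      obtain ⟨i, e, he⟩ := x
      induction e with | _ a b
      exact sunflower_adj.2 ⟨i, a, b, he, rfl, rfl⟩⟩
  have hg : Function.Injective g := by
    rintro ⟨i, e, he⟩ ⟨j, e', he'⟩ h
    have h : Sym2.map (petal R C i) e = Sym2.map (petal R C j) e' := congrArg Subtype.val h
    have hc : ∃ c, Sum.inr c ∈ e := by
      induction e with | _ a b
      rcases a with a | a
      · rcases b with b | b
        · exact (hQ _ _ he).elim
        · exact ⟨b, by simp⟩
      · exact ⟨a, by simp⟩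
    obtain ⟨c, hc⟩ := hc
    have h1 : petal R C i (.inr c) ∈ Sym2.map (petal R C j) e' := by
      rw [← h]; exact Sym2.mem_map.2 ⟨_, hc, rfl⟩
    obtain ⟨x, -, hx⟩ := Sym2.mem_map.1 h1
    have hij : i = j := by
      rcases x with x | x
      · simp at hx
      · simp only [petal_inr, Sum.inr.injEq, Prod.mk.injEq] at hx
        exact hx.1.symm
    subst hij
    have := Sym2.map.injective (petal R C i).injective h
    subst this
    rfl
  have := Nat.card_le_card_of_injective g hg
  simpa [Nat.card_prod, Nat.card_coe_set_eq] using this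

/-- The permutations of `C` that extend by the identity on `R` to automorphisms of `Q`. -/
abbrev RelAut (Q : SimpleGraph (R ⊕ C)) : Type _ :=
  {τ : Equiv.Perm C // ∀ x y, Q.Adj (Sum.map id τ x) (Sum.map id τ y) ↔ Q.Adj x y}

/-- Petals may be permuted freely, and each may independently be twisted by a relative automorphism.
A nonempty `C` makes the permutation recoverable from its action. -/
theorem factorial_mul_card_relAut_pow_le [Finite R] [Finite C] [Nonempty C]
    (Q : SimpleGraph (R ⊕ C)) (t : ℕ) :
    t.factorial * Nat.card (RelAut Q) ^ t ≤ Nat.card (sunflower Q t ≃g sunflower Q t) := by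
  let E : Equiv.Perm (Fin t) × (Fin t → RelAut Q) → Equiv.Perm (R ⊕ Fin t × C) := fun x =>
    Equiv.sumCongr (Equiv.refl R) (Equiv.prodShear x.1 fun i => (x.2 i).1)
  have hE : ∀ x i a, E x (petal R C i a) = petal R C (x.1 i) (Sum.map id (x.2 i).1 a) := by
    rintro x i (a | a) <;> rfl
  let g : Equiv.Perm (Fin t) × (Fin t → RelAut Q) → (sunflower Q t ≃g sunflower Q t) := fun x =>
    ⟨E x, by
      intro a b
      constructor
      · intro h
        obtain ⟨i, u, v, h, hu, hv⟩ := sunflower_adj.1 h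
        have hs : Function.Surjective (Sum.map id (x.2 (x.1.symm i)).1 : R ⊕ C → R ⊕ C) :=
          Function.Surjective.sumMap Function.surjective_id (x.2 (x.1.symm i)).1.surjective
        obtain ⟨u, rfl⟩ := hs u
        obtain ⟨v, rfl⟩ := hs v
        have h2 : ∀ w, petal R C i (Sum.map id (x.2 (x.1.symm i)).1 w) =
            E x (petal R C (x.1.symm i) w) := fun w => by rw [hE, Equiv.apply_symm_apply]
        rw [h2] at hu hv
        exact sunflower_adj.2 ⟨x.1.symm i, u, v, ((x.2 _).2 _ _).1 h, (E x).injective hu,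
          (E x).injective hv⟩
      · intro h
        obtain ⟨i, u, v, huv, rfl, rfl⟩ := sunflower_adj.1 h
        exact sunflower_adj.2 ⟨x.1 i, _, _, ((x.2 i).2 _ _).2 huv, (hE ..).symm, (hE ..).symm⟩⟩
  have hg : Function.Injective g := by
    rintro ⟨π, τ⟩ ⟨π', τ'⟩ h
    have h1 : ∀ i c, (π i, (τ i).1 c) = (π' i, (τ' i).1 c) := fun i c => by
      have : g (π, τ) (.inr (i, c)) = g (π', τ') (.inr (i, c)) := by rw [h]
      exact Sum.inr_injective this
    have h2 : π = π' := by
      ext i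
      exact congrArg Fin.val (Prod.ext_iff.1 (h1 i (Classical.arbitrary C))).1
    have h3 : τ = τ' := by
      ext i c
      exact (Prod.ext_iff.1 (h1 i c)).2
    rw [h2, h3]
  have := Nat.card_le_card_of_injective g hg
  rwa [Nat.card_prod, Nat.card_perm, Nat.card_fun, Nat.card_fin] at this

/-- In a sparse graph a family of `t` extensions of a fixed kernel that are disjoint outside of the
kernel cannot be too large. -/
theorem IsSparse.factorial_mul_pow_le [Finite R] [Finite C] [Nonempty C] {n : ℕ} {p : ℝ}
    {H : SimpleGraph V} (hs : IsSparse n p H) (hp : 0 ≤ p) (hp1 : p ≤ 1)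
    (Q : SimpleGraph (R ⊕ C)) (hQ : ∀ r r', ¬ Q.Adj (.inl r) (.inl r')) (t : ℕ)
    (ψ : R → V) (χ : Fin t → C → V) (hψ : Function.Injective ψ)
    (hχ : ∀ i, Function.Injective (χ i)) (hdisj : ∀ i j c c', χ i c = χ j c' → i = j)
    (hψχ : ∀ r i c, ψ r ≠ χ i c)
    (hadj : ∀ i a b, Q.Adj a b → H.Adj (Sum.elim ψ (χ i) a) (Sum.elim ψ (χ i) b)) :
    (t.factorial : ℝ) * (Nat.card (RelAut Q) : ℝ) ^ t ≤
      2 * (n : ℝ) ^ Nat.card R * ((n : ℝ) ^ Nat.card C * p ^ Q.edgeSet.ncard) ^ t := by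
  let F : R ⊕ Fin t × C → V := Sum.elim ψ fun x => χ x.1 x.2
  have hF : ∀ i a, F (petal R C i a) = Sum.elim ψ (χ i) a := by rintro i (a | a) <;> rfl
  have hFi : Function.Injective F := by
    refine Function.Injective.sumElim hψ ?_ fun r x => hψχ r x.1 x.2
    rintro ⟨i, c⟩ ⟨j, c'⟩ h
    obtain rfl := hdisj _ _ _ _ h
    exact congrArg (Prod.mk i) (hχ i h)
  let f : (sunflower Q t).Copy H := ⟨⟨F, by
    intro x y h
    obtain ⟨i, a, b, hab, rfl, rfl⟩ := sunflower_adj.1 h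
    rw [hF, hF]
    exact hadj i a b hab⟩, hFi⟩
  have h1 := hs.card_aut_le hp f
  have h2 : ((t.factorial * Nat.card (RelAut Q) ^ t : ℕ) : ℝ) ≤ _ :=
    (Nat.cast_le (α := ℝ)).2 (factorial_mul_card_relAut_pow_le Q t)
  push_cast at h2
  refine (h2.trans h1).trans ?_
  have h3 : p ^ (sunflower Q t).edgeSet.ncard ≤ p ^ (t * Q.edgeSet.ncard) :=
    pow_le_pow_of_le_one hp hp1 (card_mul_ncard_edgeSet_le_sunflower Q hQ t)
  have h4 : Nat.card (R ⊕ Fin t × C) = Nat.card R + t * Nat.card C := by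
    rw [Nat.card_sum, Nat.card_prod, Nat.card_fin]
  rw [h4]
  calc 2 * ((n : ℝ) ^ (Nat.card R + t * Nat.card C) * p ^ (sunflower Q t).edgeSet.ncard)
      ≤ 2 * ((n : ℝ) ^ (Nat.card R + t * Nat.card C) * p ^ (t * Q.edgeSet.ncard)) := by gcongr
    _ = _ := by rw [mul_comm t, mul_comm t, pow_add, pow_mul, pow_mul, mul_pow]; ring

end Sunflower

end SimpleGraph

/-! ### Elementary counting tools -/

theorem pow_self_le_three_pow_mul_factorial (t : ℕ) : (t : ℝ) ^ t ≤ 3 ^ t * t.factorial := by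
  have h := Real.pow_div_factorial_le_exp (t : ℝ) (by positivity) t
  rw [div_le_iff₀ (by positivity)] at h
  refine h.trans ?_
  gcongr
  rw [← Real.exp_one_pow]
  gcongr
  exact Real.exp_one_lt_three.le

/-- If `t! ≤ 2 * 2 ^ m * y ^ t` then `t` is at most `6 * y` or at most `m + 1`. -/
theorem le_of_factorial_le {t m : ℕ} {y : ℝ} (hy : 0 ≤ y)
    (h : (t.factorial : ℝ) ≤ 2 * 2 ^ m * y ^ t) : (t : ℝ) ≤ 6 * y ∨ t ≤ m + 1 := by
  by_contra! hc
  obtain ⟨h1, h2⟩ := hc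
  have h3 := pow_self_le_three_pow_mul_factorial t
  have hpos : (0 : ℝ) < (t : ℝ) ^ t := by
    have : 0 < t := by omega
    positivity
  have h4 : (6 * y) ^ t ≤ (t : ℝ) ^ t := by gcongr
  -- The constant 6 is 3, from `t^t ≤ 3^t t!`, times a spare 2 whose `t`-th power must beat `2^(m +
  -- 1)`.
  have h5 : (2 : ℝ) ^ t * (t : ℝ) ^ t ≤ 2 ^ (m + 1) * (t : ℝ) ^ t := by
    calc (2 : ℝ) ^ t * (t : ℝ) ^ t ≤ 2 ^ t * (3 ^ t * (2 * 2 ^ m * y ^ t)) := by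
          gcongr; exact h3.trans (by gcongr)
      _ = 2 ^ (m + 1) * (6 * y) ^ t := by
          rw [show (6 : ℝ) * y = 2 * (3 * y) by ring, mul_pow, mul_pow, pow_succ]; ring
      _ ≤ _ := by gcongr
  have h6 := le_of_mul_le_mul_right h5 hpos
  have h7 : (2 : ℝ) ^ (m + 1) < 2 ^ t := pow_lt_pow_right₀ (by norm_num) h2
  linarith

/-- A family of maps in which at most `B` members take any given value at any given point
contains a large subfamily with pairwise disjoint ranges. -/
theorem exists_disjoint_subfamily {C V : Type*} [Fintype C] [Nonempty C] [DecidableEq V]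
    [DecidableEq (C → V)] (Z : Finset (C → V)) (B : ℕ)
    (hB : ∀ c x, (Z.filter fun z => z c = x).card ≤ B) :
    ∃ M ⊆ Z, (∀ z ∈ M, ∀ z' ∈ M, ∀ c c', z c = z' c' → z = z') ∧
      Z.card ≤ M.card * (Fintype.card C * (Fintype.card C * B)) := by
  classical
  let S := Z.powerset.filter fun M => ∀ z ∈ M, ∀ z' ∈ M, ∀ c c', z c = z' c' → z = z'
  obtain ⟨M, hM, hmax⟩ := S.exists_max_image Finset.card ⟨∅, by simp [S]⟩
  simp only [S, Finset.mem_filter, Finset.mem_powerset] at hM hmax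
  refine ⟨M, hM.1, hM.2, ?_⟩
  -- By maximality every member of `Z` takes a value also taken by some member of `M`.
  have key : Z ⊆ M.biUnion fun m => Finset.univ.biUnion fun c : C =>
      Finset.univ.biUnion fun c' : C => Z.filter fun z => z c = m c' := by
    intro z hz
    simp only [Finset.mem_biUnion, Finset.mem_univ, true_and, Finset.mem_filter]
    by_contra! hc
    have hzM : z ∉ M := fun h => hc z h (Classical.arbitrary C) (Classical.arbitrary C) hz rfl
    have := hmax (insert z M) ⟨Finset.insert_subset hz hM.1, by
      intro x hx y hy c c' h
      rw [Finset.mem_insert] at hx hy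
      rcases hx with rfl | hx <;> rcases hy with rfl | hy
      · rfl
      · exact (hc y hy c c' hz h).elim
      · exact (hc x hx c' c hz h.symm).elim
      · exact hM.2 x hx y hy c c' h⟩
    rw [Finset.card_insert_of_notMem hzM] at this
    omega
  refine (Finset.card_le_card key).trans (Finset.card_biUnion_le_card_mul _ _ _ fun m _ => ?_)
  refine Finset.card_biUnion_le_card_mul _ _ _ fun c _ => ?_
  exact Finset.card_biUnion_le_card_mul _ _ _ fun c' _ => hB c _

/-- A relation-preserving map from a relation in which everything is reachable from `c₀` to a
relation with out-degrees at most `a` is encoded by its value at `c₀` and `|C| - 1` elements of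
`Fin a`. -/
theorem card_filter_le_pow_of_reachable {C V : Type*} [Fintype C] [Finite V] [DecidableEq V]
    {arc : V → V → Prop} {a : ℕ} (ha : ∀ u, {v | arc u v}.ncard ≤ a) {D : C → C → Prop} (c₀ : C)
    (hD : ∀ c, Relation.ReflTransGen D c₀ c) (Z : Finset (C → V))
    (hZ : ∀ z ∈ Z, ∀ c c', D c c' → arc (z c) (z c')) (x : V) :
    (Z.filter fun z => z c₀ = x).card ≤ a ^ (Fintype.card C - 1) := by
  classical
  have hidx : ∀ u, ∃ g : {v | arc u v} → Fin a, Function.Injective g := by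
    intro u
    have h1 : Nat.card {v | arc u v} ≤ a := by rw [Nat.card_coe_set_eq]; exact ha u
    refine ⟨fun v => Fin.castLE h1 (Finite.equivFin _ v), fun v w h => ?_⟩
    exact (Finite.equivFin _).injective (Fin.castLE_injective h1 h)
  choose idx hidx using hidx
  have key : ∀ k, k + 1 ≤ Fintype.card C → ∃ S : Finset C, S.card = k + 1 ∧ c₀ ∈ S ∧
      ∃ g : {z // z ∈ Z} → (Fin k → Fin a), ∀ z z', z.1 c₀ = z'.1 c₀ → g z = g z' →
        ∀ c ∈ S, z.1 c = z'.1 c := by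
    intro k
    induction k with
    | zero =>
      intro _
      exact ⟨{c₀}, by simp, by simp, fun _ => Fin.elim0, fun z z' h _ c hc => by
        rw [Finset.mem_singleton] at hc; rw [hc, h]⟩
    | succ k ih =>
      intro hk
      obtain ⟨S, hS, h0, g, hg⟩ := ih (by omega)
      -- Reachability from `c₀` forces an arc out of the proper subset `S`; its head has at most `a`
      -- possible images once the tail is placed.
      have : ∃ w ∈ S, ∃ w' ∉ S, D w w' := by
        by_contra! hc
        have hall : ∀ c, c ∈ S := fun c => by
          induction hD c with
          | refl => exact h0
          | tail _ h ih => by_contra hn; exact hc _ ih _ hn h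
        have : S = Finset.univ := Finset.eq_univ_iff_forall.2 hall
        rw [this, Finset.card_univ] at hS
        omega
      obtain ⟨w, hw, w', hw', hww⟩ := this
      refine ⟨insert w' S, by rw [Finset.card_insert_of_notMem hw', hS],
        Finset.mem_insert_of_mem h0,
        fun z => Fin.cons (idx (z.1 w) ⟨z.1 w', hZ z.1 z.2 _ _ hww⟩) (g z), ?_⟩
      intro z z' hx hzz c hc
      obtain ⟨h1, h2⟩ := Fin.cons_injective2 hzz
      have h3 := hg z z' hx h2
      rw [Finset.mem_insert] at hc
      rcases hc with rfl | hc
      · have hw2 := h3 w hw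
        have : ∀ u u' (hu : u = u') (y y' : V) (hy : arc u y) (hy' : arc u' y'),
            idx u ⟨y, hy⟩ = idx u' ⟨y', hy'⟩ → y = y' := by
          rintro u _ rfl y y' hy hy' h
          exact congrArg Subtype.val (hidx u h)
        exact this _ _ hw2 _ _ _ _ h1
      · exact h3 c hc
  have hpos : 0 < Fintype.card C := Fintype.card_pos_iff.2 ⟨c₀⟩
  obtain ⟨S, hS, -, g, hg⟩ := key (Fintype.card C - 1) (by omega)
  have hS : S = Finset.univ := Finset.card_eq_iff_eq_univ _ |>.1 (by omega)
  let g' : {z // z ∈ Z.filter fun z => z c₀ = x} → (Fin (Fintype.card C - 1) → Fin a) :=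
    fun z => g ⟨z.1, (Finset.mem_filter.1 z.2).1⟩
  have hg' : Function.Injective g' := fun z z' h => by
    ext c
    refine hg _ _ ?_ h c (by rw [hS]; simp)
    exact (Finset.mem_filter.1 z.2).2.trans (Finset.mem_filter.1 z'.2).2.symm
  simpa using Fintype.card_le_of_injective g' hg'

/-! ### Orientations of sparse graphs with small out-degree -/

namespace SimpleGraph

variable {V W : Type*}

/-- Only `aut P ≥ 1` is used: it gives `2^(b e) ≤ 2 n^v ≤ (2 n)^v ≤ 2^(a v)`. -/
theorem IsSparse.mul_ncard_edgeSet_le [Finite W] {n a b : ℕ} {H : SimpleGraph V}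
    (hs : IsSparse n ((2 : ℝ)⁻¹ ^ b) H) (ha : 2 * n ≤ 2 ^ a) {P : SimpleGraph W} (f : P.Copy H) :
    b * P.edgeSet.ncard ≤ a * Nat.card W := by
  have h := hs.one_le (by positivity) f
  rcases isEmpty_or_nonempty W with hW | hW
  · have : P.edgeSet = ∅ := by
      ext e; induction e with | _ x y; exact hW.elim x
    simp [this]
  · have hW : 0 < Nat.card W := Nat.card_pos
    rw [← pow_mul, inv_pow] at h
    have h2 : (2 : ℝ) ^ (b * P.edgeSet.ncard) ≤ 2 ^ (a * Nat.card W) := by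
      have h3 : (2 : ℝ) ^ (b * P.edgeSet.ncard) ≤ 2 * n ^ Nat.card W := by
        rw [← mul_assoc, ← div_eq_mul_inv, le_div_iff₀ (by positivity), one_mul] at h
        exact h
      have h4 : (2 : ℝ) * n ^ Nat.card W ≤ (2 * n) ^ Nat.card W := by
        rw [mul_pow]
        gcongr
        exact le_self_pow₀ (by norm_num) hW.ne'
      have h5 : (2 * n : ℝ) ^ Nat.card W ≤ (2 ^ a) ^ Nat.card W := by
        gcongr
        exact_mod_cast ha
      rw [pow_mul (2 : ℝ) a]
      exact h3.trans (h4.trans h5)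
    exact (pow_le_pow_iff_right₀ (by norm_num)).1 h2

/-- A sparse graph has a (possibly two-way) orientation with out-degrees at most `a` in which the
number of edges all of whose tails lie in a given set is controlled by the size of that set. -/
theorem IsSparse.exists_orientation [Finite V] {n a b : ℕ} {H : SimpleGraph V}
    (hs : IsSparse n ((2 : ℝ)⁻¹ ^ b) H) (ha : 2 * n ≤ 2 ^ a) (hb : 0 < b) :
    ∃ arc : V → V → Prop, (∀ u v, H.Adj u v → arc u v ∨ arc v u) ∧
      (∀ u, {v | arc u v}.ncard ≤ a) ∧
      ∀ (E : Set (Sym2 V)) (C : Set V), E ⊆ H.edgeSet →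
        (∀ u v, s(u, v) ∈ E → arc u v → u ∈ C) → b * E.ncard ≤ a * C.ncard := by
  classical
  have := Fintype.ofFinite V
  -- Each edge needs `b` distinct slots, and each vertex offers `a` of them to its incident edges.
  -- Hall's condition is the density bound for the subgraph induced on the endpoints. An edge is
  -- directed out of every endpoint at which it occupies a slot.
  have hall := (Finset.all_card_le_biUnion_card_iff_exists_injective
    (fun x : H.edgeSet × Fin b => x.1.1.toFinset ×ˢ (Finset.univ : Finset (Fin a)))).1 <| by
    intro s
    let E : Finset (Sym2 V) := s.image fun x => x.1.1
    let U : Finset V := E.biUnion Sym2.toFinset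
    have h1 : (s.biUnion fun x => x.1.1.toFinset ×ˢ (Finset.univ : Finset (Fin a))) =
        U ×ˢ Finset.univ := by
      ext ⟨u, i⟩
      simp [U, E]
    rw [h1, Finset.card_product, Finset.card_univ, Fintype.card_fin]
    have h2 : s.card ≤ E.card * b := by
      have : s ⊆ (s.image Prod.fst) ×ˢ (Finset.univ : Finset (Fin b)) := fun x hx => by
        simp only [Finset.mem_product, Finset.mem_univ, and_true]
        exact Finset.mem_image_of_mem _ hx
      refine (Finset.card_le_card this).trans ?_
      rw [Finset.card_product, Finset.card_univ, Fintype.card_fin]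
      have : E = (s.image Prod.fst).image Subtype.val := by
        rw [Finset.image_image]; rfl
      rw [this, Finset.card_image_of_injective _ Subtype.val_injective]
    have h3 : E.card ≤ (H.induce (U : Set V)).edgeSet.ncard := by
      rw [← Set.ncard_coe_finset]
      refine (Set.ncard_le_ncard ?_ (Set.toFinite _)).trans
        (Set.ncard_image_le (f := Sym2.map Subtype.val) (Set.toFinite _))
      intro e he
      have heU : ∀ u ∈ e, u ∈ (U : Set V) := fun u hu =>
        Finset.mem_biUnion.2 ⟨e, he, by simpa using hu⟩
      have heH : e ∈ H.edgeSet := by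
        obtain ⟨x, -, rfl⟩ := Finset.mem_image.1 he
        exact x.1.2
      induction e with | _ u v
      exact ⟨s(⟨u, heU u (by simp)⟩, ⟨v, heU v (by simp)⟩), heH, rfl⟩
    have h4 := hs.mul_ncard_edgeSet_le ha (Copy.induce H (U : Set V))
    have h5 : Nat.card (U : Set V) = U.card := by simp
    rw [h5] at h4
    nlinarith
  obtain ⟨f, hf, hfm⟩ := hall
  have hfm : ∀ x : H.edgeSet × Fin b, (f x).1 ∈ x.1.1 := fun x => by
    simpa using hfm x
  refine ⟨fun u v => ∃ h : H.Adj u v, ∃ i, (f (⟨s(u, v), h⟩, i)).1 = u, ?_, ?_, ?_⟩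
  · intro u v h
    have h1 := hfm (⟨s(u, v), h⟩, ⟨0, hb⟩)
    rcases Sym2.mem_iff.1 h1 with h2 | h2
    · exact .inl ⟨h, _, h2⟩
    · refine .inr ⟨h.symm, ⟨0, hb⟩, ?_⟩
      have : (⟨s(v, u), h.symm⟩ : H.edgeSet) = ⟨s(u, v), h⟩ := Subtype.ext Sym2.eq_swap
      rw [this]; exact h2
  · intro u
    choose h i hi using fun v : {v | ∃ h : H.Adj u v, ∃ i, (f (⟨s(u, v), h⟩, i)).1 = u} => v.2
    rw [← Nat.card_coe_set_eq]
    have hinj : Function.Injective fun v => (f (⟨s(u, v.1), (mem_edgeSet H).2 (h v)⟩, i v)).2 := by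
      intro v w hvw
      have h1 := hf (Prod.ext ((hi v).trans (hi w).symm) hvw)
      have h2 : s(u, v.1) = s(u, w.1) := congrArg (fun x => x.1.1) h1
      exact Subtype.ext (Sym2.congr_right.1 h2)
    simpa using Nat.card_le_card_of_injective _ hinj
  · intro E C hE hC
    have hmem : ∀ u e (he : e ∈ H.edgeSet) i, (f (⟨e, he⟩, i)).1 = u → e ∈ E → u ∈ C := by
      intro u e he i hu heE
      have h1 := hfm (⟨e, he⟩, i)
      rw [hu] at h1
      obtain ⟨v, rfl⟩ := Sym2.mem_iff_exists.1 h1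
      exact hC u v heE ⟨he, i, hu⟩
    let g : E × Fin b → C × Fin a := fun x =>
      (⟨(f (⟨x.1.1, hE x.1.2⟩, x.2)).1, hmem _ _ _ _ rfl x.1.2⟩, (f (⟨x.1.1, hE x.1.2⟩, x.2)).2)
    have hg : Function.Injective g := by
      rintro ⟨⟨e, he⟩, i⟩ ⟨⟨e', he'⟩, i'⟩ h
      have h1 := Prod.ext_iff.1 h
      have h2 := hf (Prod.ext (congrArg Subtype.val h1.1) h1.2)
      simpa using h2
    have := Nat.card_le_card_of_injective g hg
    rwa [Nat.card_prod, Nat.card_prod, Nat.card_coe_set_eq, Nat.card_coe_set_eq, Nat.card_fin,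
      Nat.card_fin, mul_comm, mul_comm _ a] at this

/-! ### Extending an embedding by one strongly connected piece -/

/-- The edges of `F` with both endpoints in `U`. -/
def edgesIn (F : SimpleGraph W) (U : Finset W) : Set (Sym2 W) :=
  {e | e ∈ F.edgeSet ∧ ∀ w ∈ e, w ∈ U}

/-- An injective homomorphism from `F` to `H` along which the relation `arc` pulls back to `D`. -/
def IsPatternMap (F : SimpleGraph W) (H : SimpleGraph V) (arc : V → V → Prop) (D : W → W → Prop)
    (φ : W → V) : Prop :=
  Function.Injective φ ∧ ∀ w w', F.Adj w w' → H.Adj (φ w) (φ w') ∧ (D w w' ↔ arc (φ w) (φ w'))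

/-- Strong connectivity of `C` and the out-degree bound make a large `Z` contain a large disjoint
subfamily, and sparsity bounds that subfamily as a sunflower over the already embedded neighbours of
`C`. Closedness of `U` directs all new edges out of `C`, so the density bound keeps the main term
`n^|C| p^k` from being too small to absorb the kernel's contribution. -/
theorem IsSparse.card_extensions_le [Finite V] [Finite W] [DecidableEq W] {n a b : ℕ} {H : SimpleGraph V}
    (hs : IsSparse n ((2 : ℝ)⁻¹ ^ b) H) (ha : 2 * n ≤ 2 ^ a) (ha' : 2 ^ a ≤ 4 * n) (hb : 0 < b)
    {arc : V → V → Prop}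
    (hout : ∀ u, {v | arc u v}.ncard ≤ a)
    (hdens : ∀ (E : Set (Sym2 V)) (C : Set V), E ⊆ H.edgeSet →
        (∀ u v, s(u, v) ∈ E → arc u v → u ∈ C) → b * E.ncard ≤ a * C.ncard)
    {F : SimpleGraph W} {D : W → W → Prop} (hDF : ∀ w w', D w w' → F.Adj w w')
    {φ₀ : W → V} (hφ₀ : IsPatternMap F H arc D φ₀) {U C : Finset W} (hUC : Disjoint U C)
    (hU : ∀ w ∈ U, ∀ w', D w w' → w' ∈ U)
    (hC : ∀ c c' : C, Relation.ReflTransGen (fun x y : C => D x y) c c') (hCne : C.Nonempty)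
    (Z : Finset (C → V))
    (hZ : ∀ z ∈ Z, ∃ φ, IsPatternMap F H arc D φ ∧ (∀ u ∈ U, φ u = φ₀ u) ∧ ∀ c : C, φ c = z c) :
    (Z.card : ℝ) ≤ (2 * (2 : ℝ)⁻¹ ^ b) ^ ((F.edgesIn (U ∪ C)).ncard - (F.edgesIn U).ncard) *
      (64 * a * n) ^ C.card := by
  classical
  have := Fintype.ofFinite V
  -- The kernel contains only the vertices of `U` adjacent to `C`, so that its size is at most the
  -- number `k` of new edges.
  let R := {u // u ∈ U ∧ ∃ c ∈ C, F.Adj c u}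
  let j : R ⊕ C → W := Sum.elim Subtype.val Subtype.val
  have hj : Function.Injective j :=
    Function.Injective.sumElim Subtype.val_injective Subtype.val_injective
      fun r c h => Finset.disjoint_left.1 hUC r.2.1 (h ▸ c.2)
  let Q : SimpleGraph (R ⊕ C) :=
    { Adj := fun x y => F.Adj (j x) (j y) ∧ ¬ (x.isLeft ∧ y.isLeft)
      symm := ⟨fun x y h => ⟨h.1.symm, fun h' => h.2 h'.symm⟩⟩
      loopless := ⟨fun x h => h.1.ne rfl⟩ }
  have hQ : ∀ r r', ¬ Q.Adj (.inl r) (.inl r') := fun r r' h => h.2 ⟨rfl, rfl⟩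
  have : Nonempty C := ⟨⟨_, hCne.choose_spec⟩⟩
  set k := Q.edgeSet.ncard with hk
  have hk1 : (F.edgesIn (U ∪ C)).ncard - (F.edgesIn U).ncard ≤ k := by
    rw [Nat.sub_le_iff_le_add]
    have hsub : F.edgesIn (U ∪ C) ⊆ Sym2.map j '' Q.edgeSet ∪ F.edgesIn U := by
      have aux : ∀ u v, F.Adj u v → v ∈ C → u ∈ U ∪ C → s(u, v) ∈ Sym2.map j '' Q.edgeSet := by
        intro u v huv hv hu
        by_cases hu' : u ∈ C
        · exact ⟨s(.inr ⟨u, hu'⟩, .inr ⟨v, hv⟩), ⟨huv, by simp⟩, rfl⟩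
        · have huU : u ∈ U := (Finset.mem_union.1 hu).resolve_right hu'
          exact ⟨s(.inl ⟨u, huU, v, hv, huv.symm⟩, .inr ⟨v, hv⟩), ⟨huv, by simp⟩, rfl⟩
      rintro e ⟨heF, he⟩
      induction e with | _ u v
      have hu := he u (by simp)
      have hv := he v (by simp)
      by_cases hvC : v ∈ C
      · exact .inl (aux u v heF hvC hu)
      by_cases huC : u ∈ C
      · rw [Sym2.eq_swap]; exact .inl (aux v u (heF : F.Adj u v).symm huC hv)
      · refine .inr ⟨heF, fun w hw => ?_⟩
        rcases Sym2.mem_iff.1 hw with rfl | rfl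
        · exact (Finset.mem_union.1 hu).resolve_right huC
        · exact (Finset.mem_union.1 hv).resolve_right hvC
    calc _ ≤ _ := Set.ncard_le_ncard hsub (Set.toFinite _)
      _ ≤ _ := Set.ncard_union_le _ _
      _ ≤ _ := by gcongr; exact Set.ncard_image_le (Set.toFinite _)
  have hr : Nat.card R ≤ k := by
    choose c hcC hc using fun r : R => r.2.2
    let g : R → Q.edgeSet := fun r => ⟨s(.inl r, .inr ⟨c r, hcC r⟩), (hc r).symm, by simp⟩
    have hg : Function.Injective g := fun r r' h => by
      have : s(Sum.inl r, Sum.inr (⟨c r, hcC r⟩ : C)) = s(Sum.inl r', Sum.inr ⟨c r', hcC r'⟩) :=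
        congrArg Subtype.val h
      simp only [Sym2.eq_iff, Sum.inl.injEq] at this
      simpa using this.resolve_right (by simp)|>.1
    rw [hk, ← Nat.card_coe_set_eq]
    exact Nat.card_le_card_of_injective g hg
  have hcc : Nat.card C = C.card := by simp
  set p : ℝ := (2 : ℝ)⁻¹ ^ b with hp
  have hp0 : 0 ≤ p := by positivity
  have h2p : 2 * p ≤ 1 := by
    have : p ≤ (2 : ℝ)⁻¹ := pow_le_of_le_one (by norm_num) (by norm_num) hb.ne'
    linarith
  have hc0 : 0 < C.card := hCne.card_pos
  have hn : 0 < n := by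
    by_contra! h
    have := Nat.one_le_two_pow (n := a)
    omega
  have ha0 : 0 < a := by
    rcases Nat.eq_zero_or_pos a with rfl | h
    · simp at ha; omega
    · exact h
  rcases Z.eq_empty_or_nonempty with rfl | ⟨z₀, hz₀⟩
  · simp only [Finset.card_empty, Nat.cast_zero]; positivity
  set x : ℝ := (n : ℝ) ^ C.card * p ^ k with hx
  -- No new edge has its tail in `U`: an arc from `U` to `C` would contradict that `U` is closed
  -- under `D`.
  have hjQ : ∀ {φ : W → V} (hφ : IsPatternMap F H arc D φ) (y z), Q.Adj y z →
      arc (φ (j y)) (φ (j z)) → φ (j y) ∈ φ '' C := by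
    intro φ hφ y z hyz hyz'
    rcases y with r | c
    · rcases z with r' | c
      · exact (hQ _ _ hyz).elim
      · have h1 : D r c := ((hφ.2 _ _ hyz.1).2).2 hyz'
        exact (Finset.disjoint_left.1 hUC (hU _ r.2.1 _ h1) c.2).elim
    · exact ⟨c, c.2, rfl⟩
  -- All tails of new edges lie in `C`, so `b k ≤ a |C|`; with `2^a ≤ 4 n` this reads `p^(-k) ≤ (4
  -- n)^|C|`.
  have hx4 : 1 ≤ 4 ^ C.card * x := by
    obtain ⟨φ, hφ, -, -⟩ := hZ z₀ hz₀
    have h1 := hdens (Sym2.map (φ ∘ j) '' Q.edgeSet) (φ '' C) (by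
      rintro _ ⟨e, he, rfl⟩
      induction e with | _ y z
      exact (hφ.2 _ _ (he : Q.Adj y z).1).1) (by
      rintro u v ⟨e, he, heq⟩ huv
      induction e with | _ y z
      have he : Q.Adj y z := he
      rcases Sym2.eq_iff.1 (heq : s(φ (j y), φ (j z)) = s(u, v)) with ⟨rfl, rfl⟩ | ⟨rfl, rfl⟩
      · exact hjQ hφ _ _ he huv
      · exact hjQ hφ _ _ he.symm huv)
    rw [Set.ncard_image_of_injective _ (Sym2.map.injective (hφ.1.comp hj)),
      Set.ncard_image_of_injective _ hφ.1, Set.ncard_coe_finset, ← hk] at h1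
    have h2 : (2 : ℝ) ^ (b * k) ≤ (4 * n) ^ C.card := by
      calc (2 : ℝ) ^ (b * k) ≤ 2 ^ (a * C.card) := pow_le_pow_right₀ (by norm_num) h1
        _ = (2 ^ a) ^ C.card := pow_mul _ _ _
        _ ≤ _ := by gcongr; exact_mod_cast ha'
    rw [hx, hp, ← mul_assoc, ← mul_pow, ← pow_mul, inv_pow, ← div_eq_mul_inv,
      le_div_iff₀ (by positivity), one_mul]
    exact h2
  have hx0 : 0 ≤ x := by positivity
  -- the choice of a maximal family of disjoint extensions
  have hB : ∀ (c : C) v, (Z.filter fun z => z c = v).card ≤ a ^ (Fintype.card C - 1) := by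
    intro c v
    refine card_filter_le_pow_of_reachable hout (D := fun x y : C => D x y) c (hC c) Z ?_ v
    intro z hz c c' hcc'
    obtain ⟨φ, hφ, -, h⟩ := hZ z hz
    rw [← h, ← h]
    exact ((hφ.2 _ _ (hDF _ _ hcc')).2).1 hcc'
  obtain ⟨M, hMZ, hM, hMcard⟩ := exists_disjoint_subfamily Z _ hB
  rw [Fintype.card_coe] at hMcard
  have hsun := hs.factorial_mul_pow_le hp0 (by linarith) Q hQ M.card (fun r => φ₀ r)
    (fun i => (M.equivFin.symm i).1) (hφ₀.1.comp Subtype.val_injective)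
    (fun i => by
      obtain ⟨φ, hφ, -, h⟩ := hZ _ (hMZ (M.equivFin.symm i).2)
      intro c c' hcc'
      simp only [← h] at hcc'
      exact Subtype.ext (hφ.1 hcc'))
    (fun i i' c c' h => by
      have := hM _ (M.equivFin.symm i).2 _ (M.equivFin.symm i').2 c c' h
      exact M.equivFin.symm.injective (Subtype.ext this))
    (fun r i c h => by
      obtain ⟨φ, hφ, hφU, hφ'⟩ := hZ _ (hMZ (M.equivFin.symm i).2)
      rw [← hφ', ← hφU _ r.2.1] at h
      have := hφ.1 h
      exact Finset.disjoint_left.1 hUC r.2.1 (this ▸ c.2))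
    (fun i y z hyz => by
      obtain ⟨φ, hφ, hφU, hφ'⟩ := hZ _ (hMZ (M.equivFin.symm i).2)
      have h1 : ∀ y, Sum.elim (fun r : R => φ₀ r) (M.equivFin.symm i).1 y = φ (j y) := by
        rintro (r | c)
        · exact (hφU _ r.2.1).symm
        · exact (hφ' c).symm
      rw [h1, h1]
      exact (hφ.2 _ _ hyz.1).1)
  have hA : (1 : ℝ) ≤ (Nat.card (RelAut Q) : ℝ) ^ M.card := by
    have : Nonempty (RelAut Q) := ⟨⟨1, fun x y => by
      have : (Sum.map id (1 : Equiv.Perm C) : R ⊕ C → R ⊕ C) = id := Sum.map_id_id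
      rw [this]; rfl⟩⟩
    exact one_le_pow₀ (by exact_mod_cast Nat.card_pos (α := RelAut Q))
  -- The kernel factor `n^|R|` is at most `2^(a |R|)`, so `le_of_factorial_le` applies with `m = a
  -- |R|`.
  have ht : (M.card : ℝ) ≤ 6 * x + (1 + Nat.card R * a) := by
    have h1 : (M.card.factorial : ℝ) ≤ 2 * 2 ^ (a * Nat.card R) * x ^ M.card := by
      refine (le_mul_of_one_le_right (by positivity) hA).trans (hsun.trans ?_)
      rw [hcc, pow_mul (2 : ℝ) a]
      gcongr
      have : (n : ℝ) ≤ 2 * n := by linarith [(Nat.cast_nonneg n : (0 : ℝ) ≤ n)]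
      exact this.trans (by exact_mod_cast ha)
    have h2 : (0 : ℝ) ≤ 1 + Nat.card R * a := by positivity
    rcases le_of_factorial_le hx0 h1 with h | h
    · linarith
    · have h : (M.card : ℝ) ≤ a * Nat.card R + 1 := by exact_mod_cast h
      nlinarith
  have hra : (1 + Nat.card R * a : ℝ) ≤ 2 ^ k * a := by
    have h1 : (1 + Nat.card R : ℝ) ≤ 2 ^ k := by
      have : 1 + Nat.card R ≤ 2 ^ k := (by omega : _ ≤ 1 + k).trans (by
        rw [add_comm]; exact Nat.lt_two_pow_self)
      exact_mod_cast this
    have h2 : (1 : ℝ) ≤ a := by exact_mod_cast ha0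
    calc (1 + Nat.card R * a : ℝ) ≤ (1 + Nat.card R) * a := by nlinarith
      _ ≤ _ := by gcongr
  -- The additive term `1 + |R| a ≤ 2^k a` is made multiplicative by `1 ≤ 4^|C| x`; this is where
  -- the 2 in `2 * p` comes from.
  have ht2 : (M.card : ℝ) ≤ x * 2 ^ k * a * (4 * 4 ^ C.card) := by
    have h1 : (1 + Nat.card R * a : ℝ) ≤ x * 2 ^ k * a * 4 ^ C.card := by
      calc (1 + Nat.card R * a : ℝ) ≤ 1 * (2 ^ k * a) := by rw [one_mul]; exact hra
        _ ≤ (4 ^ C.card * x) * (2 ^ k * a) := by gcongr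
        _ = _ := by ring
    have h2 : (1 : ℝ) ≤ 2 ^ k * a := by
      have h2 : (1 : ℝ) ≤ a := by exact_mod_cast ha0
      have h3 : (1 : ℝ) ≤ 2 ^ k := one_le_pow₀ (by norm_num)
      nlinarith
    have h3 : (4 : ℝ) ≤ 4 ^ C.card := le_self_pow₀ (by norm_num) hc0.ne'
    have h4 : 6 * x ≤ x * 2 ^ k * a * (3 * 4 ^ C.card) := by
      calc 6 * x ≤ x * 1 * (3 * 4) := by linarith
        _ ≤ x * (2 ^ k * a) * (3 * 4 ^ C.card) := by gcongr
        _ = _ := by ring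
    linarith
  have hcsq : (C.card : ℝ) * C.card ≤ 4 ^ C.card := by
    have : (C.card : ℝ) ≤ 2 ^ C.card := by exact_mod_cast Nat.lt_two_pow_self.le
    calc (C.card : ℝ) * C.card ≤ 2 ^ C.card * 2 ^ C.card := by gcongr
      _ = _ := by rw [← mul_pow]; norm_num
  have hfin : (Z.card : ℝ) ≤ (2 * p) ^ k * (64 * a * n) ^ C.card := by
    have h1 : (Z.card : ℝ) ≤ M.card * (C.card * (C.card * (a : ℝ) ^ (C.card - 1))) := by
      exact_mod_cast hMcard
    calc (Z.card : ℝ) ≤ M.card * (C.card * (C.card * (a : ℝ) ^ (C.card - 1))) := h1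
      _ = M.card * ((C.card * C.card) * (a : ℝ) ^ (C.card - 1)) := by ring
      _ ≤ (x * 2 ^ k * a * (4 * 4 ^ C.card)) * (4 ^ C.card * (a : ℝ) ^ (C.card - 1)) := by
          gcongr
      _ ≤ (x * 2 ^ k * a * (4 ^ C.card * 4 ^ C.card)) * (4 ^ C.card * (a : ℝ) ^ (C.card - 1)) := by
          gcongr
          exact le_self_pow₀ (by norm_num) hc0.ne'
      _ = x * 2 ^ k * (4 * 4 * 4) ^ C.card * ((a : ℝ) ^ (C.card - 1) * a) := by
          rw [mul_pow, mul_pow]; ring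
      _ = x * 2 ^ k * (4 * 4 * 4) ^ C.card * (a : ℝ) ^ C.card := by
          rw [← pow_succ, Nat.sub_add_cancel hc0]
      _ = _ := by
          rw [hx, mul_pow (2 : ℝ), mul_pow (64 * a : ℝ), mul_pow (64 : ℝ),
            show (4 * 4 * 4 : ℝ) = 64 by norm_num]
          ring
  refine hfin.trans ?_
  gcongr ?_ * _
  exact pow_le_pow_of_le_one (by positivity) h2p hk1

end SimpleGraph

/-! ### Assembling the pieces -/

theorem card_image_le_mul_of_fiber {X A B E : Type*} [DecidableEq A] [DecidableEq B]
    [DecidableEq E] (s : Finset X) (f : X → A) (g : X → B) (h : X → E) (T : ℕ)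
    (hf : ∀ x ∈ s, ∀ y ∈ s, g x = g y → h x = h y → f x = f y)
    (hT : ∀ x ∈ s, ((s.filter fun y => g y = g x).image h).card ≤ T) :
    (s.image f).card ≤ T * (s.image g).card := by
  classical
  rcases s.eq_empty_or_nonempty with rfl | ⟨x₀, -⟩
  · simp
  have : Nonempty X := ⟨x₀⟩
  have h1 : (s.image f).card ≤ (s.image fun x => (g x, h x)).card := by
    choose! k hks hk using fun a (ha : a ∈ s.image f) => Finset.mem_image.1 ha
    refine Finset.card_le_card_of_injOn (fun a => (g (k a), h (k a)))
      (fun a ha => Finset.mem_image_of_mem _ (hks a ha)) fun a ha a' ha' haa => ?_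
    obtain ⟨h2, h3⟩ := Prod.ext_iff.1 haa
    rw [← hk a ha, ← hk a' ha']
    exact hf _ (hks a ha) _ (hks a' ha') h2 h3
  refine h1.trans (Finset.card_le_mul_card_image_of_maps_to (f := Prod.fst) ?_ T ?_)
  · intro y hy
    obtain ⟨x, hx, rfl⟩ := Finset.mem_image.1 hy
    exact Finset.mem_image_of_mem _ hx
  · intro b hb
    obtain ⟨x, hx, rfl⟩ := Finset.mem_image.1 hb
    refine le_trans (Finset.card_le_card_of_injOn Prod.snd ?_ ?_) (hT x hx)
    · intro y hy
      obtain ⟨hy, hyx⟩ := Finset.mem_filter.1 hy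
      obtain ⟨y, hys, rfl⟩ := Finset.mem_image.1 hy
      exact Finset.mem_image_of_mem _ (Finset.mem_filter.2 ⟨hys, hyx⟩)
    · intro y hy y' hy' hyy
      exact Prod.ext ((Finset.mem_filter.1 hy).2.trans (Finset.mem_filter.1 hy').2.symm) hyy

namespace SimpleGraph

variable {V W : Type*}

/-- A proper subset closed under a relation can be enlarged to a closed set by a nonempty set all
of whose elements reach each other. -/
theorem exists_minimal_closed_extension [Fintype W] [DecidableEq W] (D : W → W → Prop)
    (U : Finset W) (hU : ∀ w ∈ U, ∀ w', D w w' → w' ∈ U) (hne : U ≠ Finset.univ) :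
    ∃ C : Finset W, C.Nonempty ∧ Disjoint U C ∧ (∀ w ∈ U ∪ C, ∀ w', D w w' → w' ∈ U ∪ C) ∧
      ∀ c c' : C, Relation.ReflTransGen (fun x y : C => D x y) c c' := by
  classical
  let reach : W → Finset W := fun w => (Finset.univ.filter (Relation.ReflTransGen D w)) \ U
  have hmem : ∀ w x, x ∈ reach w ↔ Relation.ReflTransGen D w x ∧ x ∉ U := by simp [reach]
  -- A vertex outside `U` with the smallest reachable set outside `U` lies in a sink component
  -- there: anything it reaches outside `U` has the same reachable set, hence reaches it back.
  obtain ⟨w, hw, hmin⟩ := (Finset.univ \ U).exists_min_image (fun w => (reach w).card) (by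
    rw [Finset.sdiff_nonempty]
    exact fun h => hne (Finset.univ_subset_iff.1 h))
  have hwU : w ∉ U := by simpa using hw
  have hclosed : ∀ {x y}, Relation.ReflTransGen D x y → x ∈ U → y ∈ U := by
    intro x y h hx
    induction h with
    | refl => exact hx
    | tail _ h ih => exact hU _ ih _ h
  refine ⟨reach w, ⟨w, (hmem _ _).2 ⟨.refl, hwU⟩⟩, ?_, ?_, ?_⟩
  · exact Finset.disjoint_sdiff
  · intro x hx y hxy
    rw [Finset.mem_union] at hx ⊢
    rcases hx with hx | hx
    · exact .inl (hU x hx y hxy)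
    · by_cases hy : y ∈ U
      · exact .inl hy
      · exact .inr ((hmem _ _).2 ⟨((hmem _ _).1 hx).1.tail hxy, hy⟩)
  · rintro ⟨c, hc⟩ ⟨c', hc'⟩
    have hc1 := (hmem _ _).1 hc
    have hsub : reach c ⊆ reach w := fun x hx =>
      (hmem _ _).2 ⟨hc1.1.trans ((hmem _ _).1 hx).1, ((hmem _ _).1 hx).2⟩
    have heq : reach c = reach w :=
      Finset.eq_of_subset_of_card_le hsub (hmin c (by simpa using hc1.2))
    have hcc : Relation.ReflTransGen D c c' := ((hmem _ _).1 (heq ▸ hc')).1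
    have hc'U := ((hmem _ _).1 hc').2
    induction hcc using Relation.ReflTransGen.head_induction_on with
    | refl => exact .refl
    | head hxy hyc ih =>
      rename_i x y
      have hyU : y ∉ U := fun h => hc'U (hclosed hyc h)
      have hy : y ∈ reach w := (hmem _ _).2 ⟨((hmem _ _).1 hc).1.tail hxy, hyU⟩
      have hy1 := (hmem _ _).1 hy
      refine Relation.ReflTransGen.head (b := ⟨y, hy⟩) hxy (ih hy hy1 ?_ ?_)
      · exact fun x hx => (hmem _ _).2 ⟨hy1.1.trans ((hmem _ _).1 hx).1, ((hmem _ _).1 hx).2⟩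
      · exact Finset.eq_of_subset_of_card_le (fun x hx =>
          (hmem _ _).2 ⟨hy1.1.trans ((hmem _ _).1 hx).1, ((hmem _ _).1 hx).2⟩)
          (hmin y (by simpa using hyU))

/-- The closed set `U` grows from `∅` to all of `W`. Each enlargement multiplies the number of
restrictions by the bound of `IsSparse.card_extensions_le`, and the exponents telescope. -/
theorem IsSparse.card_patternMap_le [Finite V] [Fintype W] {n a b : ℕ} {H : SimpleGraph V}
    (hs : IsSparse n ((2 : ℝ)⁻¹ ^ b) H) (ha : 2 * n ≤ 2 ^ a) (ha' : 2 ^ a ≤ 4 * n) (hb : 0 < b)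
    {arc : V → V → Prop}
    (hout : ∀ u, {v | arc u v}.ncard ≤ a)
    (hdens : ∀ (E : Set (Sym2 V)) (C : Set V), E ⊆ H.edgeSet →
        (∀ u v, s(u, v) ∈ E → arc u v → u ∈ C) → b * E.ncard ≤ a * C.ncard)
    {F : SimpleGraph W} {D : W → W → Prop} (hDF : ∀ w w', D w w' → F.Adj w w')
    (X : Finset (W → V)) (hX : ∀ φ ∈ X, IsPatternMap F H arc D φ) :
    (X.card : ℝ) ≤ (2 * (2 : ℝ)⁻¹ ^ b) ^ F.edgeSet.ncard * (64 * a * n) ^ Fintype.card W := by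
  classical
  set P : ℝ := 2 * (2 : ℝ)⁻¹ ^ b with hP
  set N : ℝ := 64 * a * n with hN
  have hP0 : 0 ≤ P := by positivity
  have hP1 : P ≤ 1 := by
    have : (2 : ℝ)⁻¹ ^ b ≤ (2 : ℝ)⁻¹ := pow_le_of_le_one (by norm_num) (by norm_num) hb.ne'
    rw [hP]; linarith
  have hN0 : 0 ≤ N := by positivity
  let res : (U : Finset W) → (W → V) → (U → V) := fun U φ u => φ u
  have key : ∀ m, ∀ U : Finset W, (∀ w ∈ U, ∀ w', D w w' → w' ∈ U) →
      Fintype.card W = U.card + m →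
      ((X.image (res U)).card : ℝ) ≤ P ^ (F.edgesIn U).ncard * N ^ U.card →
      (X.card : ℝ) ≤ P ^ F.edgeSet.ncard * N ^ Fintype.card W := by
    intro m
    induction m using Nat.strong_induction_on with
    | _ m ih =>
    intro U hU hm hcard
    by_cases hne : U = Finset.univ
    · subst hne
      have h1 : (X.image (res Finset.univ)).card = X.card :=
        Finset.card_image_of_injective _ fun φ φ' h => funext fun w =>
          congrFun h ⟨w, Finset.mem_univ w⟩
      have h2 : F.edgesIn Finset.univ = F.edgeSet := by ext; simp [edgesIn]
      rwa [h1, h2, Finset.card_univ] at hcard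
    · obtain ⟨C, hCne, hUC, hUC', hC⟩ := exists_minimal_closed_extension D U hU hne
      have hcU : (U ∪ C).card = U.card + C.card := Finset.card_union_of_disjoint hUC
      have hle : (U ∪ C).card ≤ Fintype.card W := Finset.card_le_univ _
      have hC0 := hCne.card_pos
      refine ih (m - C.card) (by omega) (U ∪ C) hUC' (by omega) ?_
      set d := (F.edgesIn (U ∪ C)).ncard - (F.edgesIn U).ncard with hd
      have hfib := card_image_le_mul_of_fiber X (res (U ∪ C)) (res U) (res C)
        ⌊P ^ d * N ^ C.card⌋₊ (by
          intro φ _ φ' _ h1 h2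
          funext ⟨w, hw⟩
          rcases Finset.mem_union.1 hw with h | h
          · exact congrFun h1 ⟨w, h⟩
          · exact congrFun h2 ⟨w, h⟩) (by
          intro φ₀ hφ₀
          refine Nat.le_floor ?_
          refine hs.card_extensions_le ha ha' hb hout hdens hDF (hX φ₀ hφ₀) hUC hU hC hCne _ ?_
          intro z hz
          obtain ⟨φ, hφ, rfl⟩ := Finset.mem_image.1 hz
          rw [Finset.mem_filter] at hφ
          exact ⟨φ, hX φ hφ.1, fun u hu => congrFun hφ.2 ⟨u, hu⟩, fun c => rfl⟩)
      have hmono : (F.edgesIn U).ncard ≤ (F.edgesIn (U ∪ C)).ncard :=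
        Set.ncard_le_ncard (fun e he => ⟨he.1, fun w hw =>
          Finset.mem_union_left _ (he.2 w hw)⟩) (Set.toFinite _)
      calc ((X.image (res (U ∪ C))).card : ℝ)
          ≤ (⌊P ^ d * N ^ C.card⌋₊ : ℝ) * (X.image (res U)).card := by exact_mod_cast hfib
        _ ≤ (P ^ d * N ^ C.card) * (P ^ (F.edgesIn U).ncard * N ^ U.card) := by
            gcongr
            exact Nat.floor_le (by positivity)
        _ = P ^ (d + (F.edgesIn U).ncard) * N ^ (U.card + C.card) := by
            rw [pow_add, pow_add]; ring
        _ = _ := by rw [hcU, hd, Nat.sub_add_cancel hmono]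
  refine key (Fintype.card W) ∅ (by simp) (by simp) ?_
  have h1 : (F.edgesIn ∅) = ∅ := by
    refine Set.eq_empty_of_forall_notMem fun e he => ?_
    induction e with | _ u v
    simpa using he.2 u (by simp)
  rw [h1]
  simp only [Set.ncard_empty, pow_zero, Finset.card_empty, mul_one]
  have : (X.image (res ∅)).card ≤ 1 := Finset.card_le_one.2 fun x _ y _ => Subsingleton.elim _ _
  exact_mod_cast this

/-- Embeddings are sorted by the set of darts of `F` sent to arcs. There are `2e` darts, hence `4^e`
patterns, which turns the factor 2 into 8. -/
theorem IsSparse.card_copy_le [Finite V] [Finite W] {n a b : ℕ} {H : SimpleGraph V}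
    (hs : IsSparse n ((2 : ℝ)⁻¹ ^ b) H) (ha : 2 * n ≤ 2 ^ a) (ha' : 2 ^ a ≤ 4 * n) (hb : 0 < b)
    (F : SimpleGraph W) :
    (Nat.card (F.Copy H) : ℝ) ≤
      (8 * (2 : ℝ)⁻¹ ^ b) ^ F.edgeSet.ncard * (64 * a * n) ^ Nat.card W := by
  classical
  have := Fintype.ofFinite V
  have := Fintype.ofFinite W
  have := Fintype.ofFinite (F.Copy H)
  obtain ⟨arc, harc, hout, hdens⟩ := hs.exists_orientation ha hb
  let pat : F.Copy H → Set F.Dart := fun f => {d | arc (f d.fst) (f d.snd)}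
  have hfib : ∀ S : Set F.Dart, ((Finset.univ.filter fun f : F.Copy H => pat f = S).card : ℝ) ≤
      (2 * (2 : ℝ)⁻¹ ^ b) ^ F.edgeSet.ncard * (64 * a * n) ^ Fintype.card W := by
    intro S
    have h1 := hs.card_patternMap_le ha ha' hb hout hdens (F := F)
      (D := fun w w' => ∃ h : F.Adj w w', (⟨(w, w'), h⟩ : F.Dart) ∈ S) (fun w w' h => h.1)
      ((Finset.univ.filter fun f : F.Copy H => pat f = S).image (DFunLike.coe : F.Copy H → W → V)) (by
        intro φ hφ
        obtain ⟨f, hf, rfl⟩ := Finset.mem_image.1 hφ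
        simp only [Finset.mem_filter, Finset.mem_univ, true_and] at hf
        subst hf
        refine ⟨f.injective, fun w w' h => ⟨f.adj h, ?_⟩⟩
        simp [pat, h])
    rwa [Finset.card_image_of_injective _ (DFunLike.coe_injective (F := F.Copy H))] at h1
  have hcard : Fintype.card (F.Copy H) =
      ∑ S : Set F.Dart, (Finset.univ.filter fun f : F.Copy H => pat f = S).card := by
    rw [← Finset.card_univ, Finset.card_eq_sum_card_fiberwise (t := Finset.univ) (f := pat)
      (by simp)]
  have hdart : Fintype.card (Set F.Dart) = 4 ^ F.edgeSet.ncard := by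
    rw [Fintype.card_set, F.dart_card_eq_twice_card_edges, pow_mul, ← coe_edgeFinset,
      Set.ncard_coe_finset]
    norm_num
  rw [Nat.card_eq_fintype_card, Nat.card_eq_fintype_card, hcard]
  push_cast
  calc _ ≤ ∑ S : Set F.Dart,
        (2 * (2 : ℝ)⁻¹ ^ b) ^ F.edgeSet.ncard * (64 * a * n) ^ Fintype.card W :=
        Finset.sum_le_sum fun S _ => hfib S
    _ = _ := by
      rw [Finset.sum_const, Finset.card_univ, hdart, nsmul_eq_mul]
      push_cast
      rw [← mul_assoc, ← mul_pow]
      ring_nf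

end SimpleGraph

/-! ### Falling factorials and removal of isolated vertices -/

theorem Nat.factorial_mul_pow_le_pow_mul_descFactorial {n v : ℕ} (h : v ≤ n) :
    v.factorial * n ^ v ≤ v ^ v * n.descFactorial v := by
  rw [← Nat.descFactorial_self, Nat.descFactorial_eq_prod_range, Nat.descFactorial_eq_prod_range]
  have h1 : ∏ i ∈ Finset.range v, ((v - i) * n) ≤ ∏ i ∈ Finset.range v, (v * (n - i)) := by
    refine Finset.prod_le_prod' fun i hi => ?_
    rw [Nat.sub_mul, Nat.mul_sub]
    have := Nat.mul_le_mul_left i h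
    rw [mul_comm i v] at this
    omega
  rw [Finset.prod_mul_distrib, Finset.prod_mul_distrib] at h1
  simpa using h1

theorem pow_le_three_pow_mul_descFactorial {n v : ℕ} (h : v ≤ n) :
    (n : ℝ) ^ v ≤ 3 ^ v * n.descFactorial v := by
  have h1 : (v.factorial : ℝ) * n ^ v ≤ v ^ v * n.descFactorial v := by
    exact_mod_cast Nat.factorial_mul_pow_le_pow_mul_descFactorial h
  have h2 := pow_self_le_three_pow_mul_factorial v
  have h3 : (0 : ℝ) < v.factorial := by positivity
  have h4 : (0 : ℝ) ≤ n.descFactorial v := by positivity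
  refine le_of_mul_le_mul_left ?_ h3
  nlinarith

namespace SimpleGraph

variable {V W : Type*}

theorem card_le_two_mul_ncard_edgeSet [Finite W] {F : SimpleGraph W} (h : ∀ w, ∃ w', F.Adj w w') :
    Nat.card W ≤ 2 * F.edgeSet.ncard := by
  classical
  have := Fintype.ofFinite W
  choose f hf using h
  have h1 : Function.Injective fun w => (⟨(w, f w), hf w⟩ : F.Dart) := fun w w' h => by
    simpa using congrArg (fun d => d.fst) h
  rw [← coe_edgeFinset, Set.ncard_coe_finset, ← dart_card_eq_twice_card_edges,
    Nat.card_eq_fintype_card]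
  exact Fintype.card_le_of_injective _ h1

theorem exists_adj_induce_support (J : SimpleGraph W) (w : J.support) :
    ∃ w', (J.induce J.support).Adj w w' := by
  obtain ⟨w', h⟩ := J.mem_support.1 w.2
  exact ⟨⟨w', J.mem_support.2 ⟨_, h.symm⟩⟩, h⟩

theorem ncard_edgeSet_induce_support (J : SimpleGraph W) :
    (J.induce J.support).edgeSet.ncard = J.edgeSet.ncard := by
  rw [← Set.ncard_image_of_injective _ (Sym2.map.injective Subtype.val_injective)]
  congr 1
  ext e
  constructor
  · rintro ⟨e, he, rfl⟩
    induction e with | _ a b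
    exact he
  · intro he
    induction e with | _ a b
    exact ⟨s(⟨a, J.mem_support.2 ⟨b, he⟩⟩, ⟨b, J.mem_support.2 ⟨a, (he : J.Adj a b).symm⟩⟩),
      he, rfl⟩

theorem card_copy_le_induce_mul [Finite V] [Finite W] (J : SimpleGraph W) (S : Set W)
    (H : SimpleGraph V) :
    Nat.card (J.Copy H) ≤ Nat.card ((J.induce S).Copy H) *
      (Nat.card V - Nat.card S).descFactorial (Nat.card W - Nat.card S) := by
  classical
  have := Fintype.ofFinite V
  have := Fintype.ofFinite W
  have := Fintype.ofFinite ((J.induce S).Copy H)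
  let X := Σ f : (J.induce S).Copy H, ({w // w ∉ S} ↪ {v // v ∉ Set.range f})
  let g : J.Copy H → X := fun f => ⟨f.comp (Copy.induce J S),
    ⟨fun w => ⟨f w, by
      rintro ⟨⟨w', hw'⟩, h⟩
      have h := f.inj (h : f w' = f w)
      exact w.2 (h ▸ hw')⟩, fun w w' h => Subtype.ext (f.inj (congrArg Subtype.val h))⟩⟩
  let k : X → W → V := fun x w => if h : w ∈ S then x.1 ⟨w, h⟩ else (x.2 ⟨w, h⟩).1
  have hg : Function.Injective g := by
    have hk : ∀ f, k (g f) = f := fun f => by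
      funext w
      by_cases h : w ∈ S
      · simp only [k, h, dif_pos]; rfl
      · simp only [k, h, dif_neg, not_false_eq_true]; rfl
    intro f f' h
    exact DFunLike.coe_injective (by rw [← hk f, ← hk f', h])
  have h1 := Nat.card_le_card_of_injective g hg
  refine h1.trans (le_of_eq ?_)
  rw [Nat.card_sigma]
  have h2 : ∀ f : (J.induce S).Copy H, Nat.card ({w // w ∉ S} ↪ {v // v ∉ Set.range f}) =
      (Nat.card V - Nat.card S).descFactorial (Nat.card W - Nat.card S) := by
    intro f
    rw [Nat.card_eq_fintype_card, Fintype.card_embedding_eq]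
    congr 1
    · rw [Fintype.card_subtype_compl, Nat.card_eq_fintype_card, Nat.card_eq_fintype_card]
      congr 1
      exact Set.card_range_of_injective f.injective
    · rw [Fintype.card_subtype_compl, Nat.card_eq_fintype_card, Nat.card_eq_fintype_card]
  simp only [h2, Finset.sum_const, Finset.card_univ, smul_eq_mul, Nat.card_eq_fintype_card]

/-- Once the `s` vertices of the support are placed, the isolated vertices have at most `(n -
s)_(|W| - s)` placements, which is exactly the ratio of the two falling factorials. Isolated
vertices thus cost nothing, and afterwards `v ≤ 2e` is available. -/
theorem card_copy_le_of_induce_support [Finite V] [Finite W] {n : ℕ} {q : ℝ}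
    (J : SimpleGraph W) (H : SimpleGraph V) (hV : Nat.card V ≤ n)
    (h : (Nat.card ((J.induce J.support).Copy H) : ℝ) ≤
      n.descFactorial (Nat.card J.support) * q ^ (J.induce J.support).edgeSet.ncard) :
    (Nat.card (J.Copy H) : ℝ) ≤ n.descFactorial (Nat.card W) * q ^ J.edgeSet.ncard := by
  set s := Nat.card J.support
  have hs : s ≤ Nat.card W := Finite.card_subtype_le _
  have h1 : (Nat.card (J.Copy H) : ℝ) ≤ Nat.card ((J.induce J.support).Copy H) *
      (n - s).descFactorial (Nat.card W - s) := by
    have h2 : (Nat.card V - s).descFactorial (Nat.card W - s) ≤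
        (n - s).descFactorial (Nat.card W - s) := Nat.descFactorial_le _ (by omega)
    exact_mod_cast (card_copy_le_induce_mul J J.support H).trans (Nat.mul_le_mul_left _ h2)
  have h3 : (n.descFactorial (Nat.card W) : ℝ) =
      (n - s).descFactorial (Nat.card W - s) * n.descFactorial s := by
    exact_mod_cast (Nat.descFactorial_mul_descFactorial hs).symm
  rw [ncard_edgeSet_induce_support] at h
  calc _ ≤ _ := h1
    _ ≤ (n.descFactorial s * q ^ J.edgeSet.ncard) * (n - s).descFactorial (Nat.card W - s) := by
        gcongr
    _ = _ := by rw [h3]; ring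

theorem card_copy_eq_zero_or_card_le [Finite V] [Finite W] (F : SimpleGraph W)
    (H : SimpleGraph V) : Nat.card (F.Copy H) = 0 ∨ Nat.card W ≤ Nat.card V := by
  rcases isEmpty_or_nonempty (F.Copy H) with h | ⟨⟨f⟩⟩
  · exact .inl Nat.card_of_isEmpty
  · exact .inr (Nat.card_le_card_of_injective f f.injective)

theorem IsSparse.card_copy_le_descFactorial [Finite V] [Finite W] {n a b : ℕ} {H : SimpleGraph V}
    (hs : IsSparse n ((2 : ℝ)⁻¹ ^ b) H) (ha : 2 * n ≤ 2 ^ a) (ha' : 2 ^ a ≤ 4 * n) (hb : 0 < b)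
    (hV : Nat.card V ≤ n) (F : SimpleGraph W) :
    (Nat.card (F.Copy H) : ℝ) ≤ n.descFactorial (Nat.card W) *
      (294912 * a ^ 2 * (2 : ℝ)⁻¹ ^ b) ^ F.edgeSet.ncard := by
  refine card_copy_le_of_induce_support F H hV ?_
  have hiso := card_le_two_mul_ncard_edgeSet F.exists_adj_induce_support
  generalize F.induce F.support = F' at *
  rcases card_copy_eq_zero_or_card_le F' H with h0 | hW
  · rw [h0]; push_cast; positivity
  have h1 := hs.card_copy_le ha ha' hb F'
  have h2 := pow_le_three_pow_mul_descFactorial (hW.trans hV)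
  set v := Nat.card F.support
  set e := F'.edgeSet.ncard
  have ha1 : (1 : ℝ) ≤ a := by
    have : a ≠ 0 := by
      rintro rfl
      omega
    exact_mod_cast Nat.one_le_iff_ne_zero.2 this
  calc _ ≤ _ := h1
    _ = (8 * (2 : ℝ)⁻¹ ^ b) ^ e * (64 * a) ^ v * n ^ v := by rw [mul_pow (64 * a : ℝ)]; ring
    _ ≤ (8 * (2 : ℝ)⁻¹ ^ b) ^ e * (64 * a) ^ v * (3 ^ v * n.descFactorial v) := by gcongr
    _ = (8 * (2 : ℝ)⁻¹ ^ b) ^ e * (64 * a * 3) ^ v * n.descFactorial v := by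
        rw [mul_pow (64 * a : ℝ)]; ring
    -- The loss per vertex becomes a loss per edge through `v ≤ 2e`; the square here is the source
    -- of `log² n`. The constant is `8 * 192^2 = 294912`.
    _ ≤ (8 * (2 : ℝ)⁻¹ ^ b) ^ e * (64 * a * 3) ^ (2 * e) * n.descFactorial v := by
        gcongr
        linarith
    _ = n.descFactorial v * ((8 * (2 : ℝ)⁻¹ ^ b) ^ e * ((64 * a * 3) ^ 2) ^ e) := by
        rw [pow_mul]; ring
    _ = _ := by
        rw [← mul_pow]; congr 2; ring

/-! ### The bound with the squared logarithm -/

theorem one_lt_card_of_ne_bot [Finite V] {H : SimpleGraph V} (hH : H ≠ ⊥) : 1 < Nat.card V := by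
  by_contra! h
  have := (Finite.card_le_one_iff_subsingleton).1 h
  exact hH (Subsingleton.elim _ _)

theorem edgeSet_ncard_ne_zero_of_ne_bot [Finite V] {H : SimpleGraph V} (hH : H ≠ ⊥) :
    H.edgeSet.ncard ≠ 0 := by
  rw [Ne, Set.ncard_eq_zero]
  simpa using hH

theorem graphicThreshold_pos [Fintype V] {n : ℕ} {H : SimpleGraph V} (hH : H ≠ ⊥)
    (hn : Fintype.card V ≤ n) : 0 < (graphicThreshold n H : ℝ) := by
  have hs := isSparse_of_mem_graphicFeasible (isLeast_graphicThreshold n H hn).1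
  refine lt_of_le_of_ne (graphicThreshold n H).2.1 fun h => ?_
  rw [← h] at hs
  have := hs.one_le le_rfl (Copy.id H)
  rw [zero_pow (edgeSet_ncard_ne_zero_of_ne_bot hH)] at this
  norm_num at this

theorem fractionalThreshold_le_of_card_copy_le [Fintype V] {n : ℕ} {q : ℝ} {H : SimpleGraph V}
    (hq : 0 ≤ q) (h : ∀ J : H.Subgraph, (Nat.card (J.coe.Copy H) : ℝ) ≤
      n.descFactorial (Nat.card J.verts) * q ^ J.coe.edgeSet.ncard) :
    (fractionalThreshold n H : ℝ) ≤ q := by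
  rcases le_total 1 q with h1 | h1
  · exact (fractionalThreshold n H).2.2.trans h1
  · have : fractionalThreshold n H ≤ (⟨q, hq, h1⟩ : I) :=
      sInf_le (mem_fractionalFeasible_of_card_copy_le h)
    exact this

theorem fractionalThreshold_lt_mul_log_sq [Fintype V] (n : ℕ) (H : SimpleGraph V)
    (hn : Fintype.card V ≤ n) (hH : H ≠ ⊥) :
    (fractionalThreshold n H : ℝ) <
      5308416 * (graphicThreshold n H : ℝ) * (Real.logb 2 n) ^ 2 := by
  have hp0 := graphicThreshold_pos hH hn
  have hs := isSparse_of_mem_graphicFeasible (isLeast_graphicThreshold n H hn).1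
  set p : ℝ := (graphicThreshold n H : ℝ)
  have hV := one_lt_card_of_ne_bot hH
  rw [Nat.card_eq_fintype_card] at hV
  have hn2 : 2 ≤ n := by omega
  have hn2' : (2 : ℝ) ≤ n := by exact_mod_cast hn2
  have hL : 1 ≤ Real.logb 2 n := by
    rw [Real.le_logb_iff_rpow_le (by norm_num) (by linarith)]
    simpa using hn2'
  set L := Real.logb 2 n with hLdef
  have hL2 : 1 ≤ L ^ 2 := one_le_pow₀ hL
  -- For `p > 1/2` the trivial bound 1 on the threshold suffices; otherwise rounding `p` up to a
  -- power `2^(-b)` yields `b > 0` and loses less than a factor 2.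
  rcases lt_or_ge (1 / 2) p with hp | hp
  · have := (fractionalThreshold n H).2.2
    nlinarith
  obtain ⟨b, hb1, hb2⟩ := exists_nat_pow_near_of_lt_one hp0 (by linarith : p ≤ 1)
    (by norm_num : (0 : ℝ) < 2⁻¹) (by norm_num)
  have hb : 0 < b := by
    by_contra! h
    have : b = 0 := by omega
    subst this
    norm_num at hb1
    linarith
  obtain ⟨a, ha, ha'⟩ : ∃ a, 2 * n ≤ 2 ^ a ∧ 2 ^ a ≤ 4 * n := by
    refine ⟨Nat.clog 2 n + 1, ?_, ?_⟩
    · have := Nat.le_pow_clog (b := 2) (by norm_num) n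
      rw [pow_succ]; omega
    · have h1 := Nat.pow_pred_clog_lt_self (b := 2) (by norm_num) hn2
      have h2 : 0 < Nat.clog 2 n := Nat.clog_pos (by norm_num) hn2
      have h3 : Nat.clog 2 n + 1 = (Nat.clog 2 n).pred + 2 := by
        rw [Nat.pred_eq_sub_one]; omega
      rw [h3, pow_add]; omega
  have haL : (a : ℝ) ≤ 3 * L := by
    have h1 : (a : ℝ) ≤ Real.logb 2 (4 * n) := by
      rw [Real.le_logb_iff_rpow_le (by norm_num) (by positivity), Real.rpow_natCast]
      exact_mod_cast ha'
    have h2 : Real.logb 2 (4 * n) = 2 + L := by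
      rw [Real.logb_mul (by norm_num) (by positivity), show (4 : ℝ) = 2 ^ (2 : ℝ) by norm_num,
        Real.logb_rpow (by norm_num) (by norm_num)]
    linarith
  have hle := fractionalThreshold_le_of_card_copy_le (q := 294912 * a ^ 2 * (2 : ℝ)⁻¹ ^ b)
    (by positivity) fun J => (hs.mono hp0.le hb2).card_copy_le_descFactorial ha ha' hb
      (by rwa [Nat.card_eq_fintype_card]) J.coe
  refine hle.trans_lt ?_
  have h2 : (2 : ℝ)⁻¹ ^ b < 2 * p := by
    rw [pow_succ] at hb1; linarith
  calc 294912 * (a : ℝ) ^ 2 * (2 : ℝ)⁻¹ ^ b ≤ 294912 * (3 * L) ^ 2 * (2 : ℝ)⁻¹ ^ b := by gcongr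
    _ < 294912 * (3 * L) ^ 2 * (2 * p) := by gcongr
    _ = _ := by ring

/-! ### The regime where `n p` is at most one third -/

/-- When `n p ≤ 1 / 3`, every connected subgraph of a sparse graph is a tree. -/
theorem IsSparse.ncard_edgeSet_add_one [Finite W] {n : ℕ} {p : ℝ} {H : SimpleGraph V}
    (hs : IsSparse n p H) (hp : 0 ≤ p) (hp1 : p ≤ 1) (hnp : n * p ≤ 1 / 3) {P : SimpleGraph W}
    (hP : P.Connected) (f : P.Copy H) : P.edgeSet.ncard + 1 = Nat.card W := by
  have h1 := hP.card_vert_le_card_edgeSet_add_one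
  rw [Nat.card_coe_set_eq] at h1
  refine le_antisymm ?_ h1
  by_contra! hlt
  have := hP.nonempty
  have hW : 0 < Nat.card W := Nat.card_pos
  have h2 := hs.one_le hp f
  -- With as many edges as vertices, sparsity would give `1 ≤ 2 (n p)^v ≤ 2/3`.
  have h3 : p ^ P.edgeSet.ncard ≤ p ^ Nat.card W := pow_le_pow_of_le_one hp hp1 (by omega)
  have h4 : (n : ℝ) ^ Nat.card W * p ^ P.edgeSet.ncard ≤ (n * p) ^ Nat.card W := by
    rw [mul_pow]; gcongr
  have h5 : (n * p) ^ Nat.card W ≤ n * p := pow_le_of_le_one (by positivity) (by linarith) hW.ne'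
  linarith

instance [Finite V] {H : SimpleGraph V} (c : H.ConnectedComponent) : Finite c :=
  inferInstanceAs (Finite c.supp)

/-- The inclusion of a connected component. -/
def ConnectedComponent.copy {H : SimpleGraph V} (c : H.ConnectedComponent) :
    c.toSimpleGraph.Copy H := ⟨c.toSimpleGraph_hom, Subtype.val_injective⟩

/-- The number of isomorphisms from connected components of a sparse graph to a given graph. -/
theorem IsSparse.card_component_iso_le [Finite V] [Finite W] [Nonempty W] {n : ℕ} {p : ℝ}
    {H : SimpleGraph V} (hs : IsSparse n p H) (hp : 0 ≤ p) (hp1 : p ≤ 1) (L : SimpleGraph W) :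
    (Nat.card (Σ c : H.ConnectedComponent, c.toSimpleGraph ≃g L) : ℝ) ≤
      6 * (n ^ Nat.card W * p ^ L.edgeSet.ncard) := by
  classical
  have := Fintype.ofFinite H.ConnectedComponent
  let S := {c : H.ConnectedComponent // Nonempty (c.toSimpleGraph ≃g L)}
  set m := Nat.card S with hm
  set A := Nat.card (L ≃g L) with hA
  have hA0 : (0 : ℝ) < A := by exact_mod_cast card_aut_pos L
  have hcount : Nat.card (Σ c : H.ConnectedComponent, c.toSimpleGraph ≃g L) = m * A := by
    rw [Nat.card_sigma]
    have h1 : ∀ c : H.ConnectedComponent, Nat.card (c.toSimpleGraph ≃g L) =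
        if Nonempty (c.toSimpleGraph ≃g L) then A else 0 := by
      intro c
      split_ifs with h
      · rw [card_iso_eq_of_iso h.some, ← card_aut_congr h.some]
      · have := not_nonempty_iff.1 h
        exact Nat.card_of_isEmpty
    simp only [h1]
    rw [← Finset.sum_filter, Finset.sum_const, smul_eq_mul, hm, Nat.card_eq_fintype_card,
      Fintype.card_subtype]
  -- Distinct components are disjoint, so those isomorphic to `L` form a sunflower with empty
  -- kernel, whose relative automorphisms are the automorphisms of `L`.
  let Q : SimpleGraph (PEmpty.{1} ⊕ W) := L.map (Function.Embedding.inr)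
  have hQadj : ∀ x y, Q.Adj (.inr x) (.inr y) ↔ L.Adj x y := fun x y => by
    simp only [Q]
    exact map_adj_apply (f := Function.Embedding.inr)
  have hRA : Nat.card (RelAut Q) = A := Nat.card_congr
    { toFun := fun τ => ⟨τ.1, by
        intro x y
        have := τ.2 (.inr x) (.inr y)
        rw [hQadj] at this
        rw [← this]
        exact (hQadj _ _).symm⟩
      invFun := fun τ => ⟨τ.toEquiv, by
        rintro (x | x) (y | y)
        · exact x.elim
        · exact x.elim
        · exact y.elim
        · rw [hQadj]
          exact (hQadj _ _).trans τ.map_adj_iff⟩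
      left_inv := fun τ => rfl
      right_inv := fun τ => rfl }
  have hQe : Q.edgeSet.ncard = L.edgeSet.ncard := ncard_edgeSet_map L _
  let e : Fin m ≃ S := (Finite.equivFin S).symm
  let iso : ∀ i, L ≃g (e i).1.toSimpleGraph := fun i => (e i).2.some.symm
  have hsun := hs.factorial_mul_pow_le hp hp1 Q (fun r => r.elim) m PEmpty.elim
    (fun i w => (iso i w : V)) (fun r => r.elim)
    (fun i w w' h => (iso i).injective (Subtype.ext h))
    (fun i j w w' h => by
      have h1 : (e i).1 = (e j).1 := by
        rw [← ConnectedComponent.mem_supp_iff _ _ |>.1 (iso i w).2,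
          ← ConnectedComponent.mem_supp_iff _ _ |>.1 (iso j w').2]
        exact congrArg _ h
      exact e.injective (Subtype.ext h1))
    (fun r => r.elim) (by
      rintro i (x | x) (y | y) h
      · exact x.elim
      · exact x.elim
      · exact y.elim
      · exact (iso i).map_adj_iff.2 ((hQadj _ _).1 h))
  rw [hRA, hQe, Nat.card_of_isEmpty (α := PEmpty), pow_zero, mul_one] at hsun
  set x : ℝ := n ^ Nat.card W * p ^ L.edgeSet.ncard with hx
  have hx0 : 0 ≤ x := by positivity
  rw [hcount]
  push_cast
  have h1 : (m.factorial : ℝ) ≤ 2 * 2 ^ 0 * (x / A) ^ m := by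
    rw [div_pow, pow_zero, mul_one, mul_div_assoc', le_div_iff₀ (by positivity)]
    exact hsun
  rcases le_of_factorial_le (by positivity) h1 with h | h
  · calc (m : ℝ) * A ≤ 6 * (x / A) * A := by gcongr
      _ = _ := by field_simp
  · rcases (by omega : m = 0 ∨ m = 1) with h0 | h0
    · rw [h0, Nat.cast_zero, zero_mul]; positivity
    · rw [h0] at hsun ⊢
      simp only [Nat.factorial_one, Nat.cast_one, pow_one, one_mul] at hsun ⊢
      linarith

/-- Every vertex outside a nonempty set has a neighbour that is closer to the set. -/
theorem Connected.exists_rank {L : SimpleGraph V} (hL : L.Connected) {S : Set V}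
    (hS : S.Nonempty) : ∃ d : V → ℕ, ∀ x ∉ S, ∃ y, L.Adj x y ∧ d y < d x := by
  refine ⟨fun x => sInf ((fun s => L.dist x s) '' S), fun x hx => ?_⟩
  obtain ⟨s, hs, h⟩ : sInf ((fun s => L.dist x s) '' S) ∈ (fun s => L.dist x s) '' S :=
    Nat.sInf_mem (hS.image _)
  obtain ⟨w, hw⟩ := hL.exists_walk_length_eq_dist x s
  have h : L.dist x s = sInf ((fun s => L.dist x s) '' S) := h
  cases w with
  | nil => exact (hx hs).elim
  | cons hxy q =>
    rename_i y
    refine ⟨y, hxy, ?_⟩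
    have h1 : sInf ((fun s => L.dist y s) '' S) ≤ L.dist y s := Nat.sInf_le ⟨s, hs, rfl⟩
    have h2 := dist_le q
    rw [Walk.length_cons] at hw
    simp only at h1 ⊢
    omega

/-- A tree containing a copy of a connected graph consists of that copy and the edges joining each
remaining vertex to its parent. -/
theorem edgeSet_eq_of_parent [Finite V] [Finite W] {F : SimpleGraph W} (hF : F.Connected)
    {L : SimpleGraph V} (hL : L.edgeSet.ncard + 1 = Nat.card V) (φ : F.Copy L) (d : V → ℕ)
    (π : V → V) (hπ : ∀ x ∉ Set.range φ, L.Adj x (π x) ∧ d (π x) < d x) :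
    L.edgeSet = Sym2.map φ '' F.edgeSet ∪ (fun x => s(x, π x)) '' (Set.range φ)ᶜ := by
  have hφ : Function.Injective φ := φ.injective
  symm
  refine Set.eq_of_subset_of_ncard_le ?_ ?_ (Set.toFinite _)
  · rintro _ (⟨e, he, rfl⟩ | ⟨x, hx, rfl⟩)
    · induction e with | _ a b
      exact φ.adj he
    · exact (hπ x hx).1
  -- The right side has at least `(|W| - 1) + (|V| - |W|)` edges, all those a tree can have. Parent
  -- edges are distinct because `d` drops strictly along them, and none lies in the copy because
  -- each has an endpoint outside it.
  · rw [Set.ncard_union_eq ?_ (Set.toFinite _) (Set.toFinite _),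
      Set.ncard_image_of_injective _ (Sym2.map.injective hφ),
      Set.InjOn.ncard_image ?_]
    · have h1 := hF.card_vert_le_card_edgeSet_add_one
      rw [Nat.card_coe_set_eq] at h1
      have h2 := Set.ncard_add_ncard_compl (Set.range φ)
      have h3 : (Set.range φ).ncard = Nat.card W := by
        rw [← Set.image_univ, Set.ncard_image_of_injective _ hφ, Set.ncard_univ]
      omega
    · intro x hx y hy hxy
      rcases Sym2.eq_iff.1 hxy with ⟨h, -⟩ | ⟨h1, h2⟩
      · exact h
      · have h3 := (hπ x hx).2
        have h4 := (hπ y hy).2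
        rw [h2] at h3
        rw [← h1] at h4
        omega
    · rw [Set.disjoint_left]
      rintro _ ⟨e, he, rfl⟩ ⟨x, hx, h⟩
      have h1 : x ∈ Sym2.map φ e := by
        rw [← h]; simp
      obtain ⟨w, -, hw⟩ := Sym2.mem_map.1 h1
      exact hx ⟨w, hw⟩

/-- The number of pairs of a labelled tree on `v` vertices and a copy of a fixed connected graph
inside it. -/
theorem sum_card_copy_tree_le [Fintype W] {F : SimpleGraph W} (hF : F.Connected) (v : ℕ) :
    Nat.card (Σ L : {L : SimpleGraph (Fin v) // L.Connected ∧ L.edgeSet.ncard + 1 = v},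
      F.Copy L.1) ≤ v.descFactorial (Fintype.card W) * v ^ (v - Fintype.card W) := by
  classical
  let T := Σ L : {L : SimpleGraph (Fin v) // L.Connected ∧ L.edgeSet.ncard + 1 = v}, F.Copy L.1
  have hne := hF.nonempty
  have hex : ∀ x : T, ∃ π : Fin v → Fin v, x.1.1.edgeSet =
      Sym2.map x.2 '' F.edgeSet ∪ (fun y => s(y, π y)) '' (Set.range x.2)ᶜ := by
    rintro ⟨⟨L, hL, hLe⟩, φ⟩
    obtain ⟨d, hd⟩ := hL.exists_rank (Set.range_nonempty φ)
    have hd' : ∀ x, ∃ y, x ∉ Set.range φ → L.Adj x y ∧ d y < d x := fun x => by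
      by_cases hx : x ∈ Set.range φ
      · exact ⟨x, fun h => (h hx).elim⟩
      · obtain ⟨y, hy⟩ := hd x hx
        exact ⟨y, fun _ => hy⟩
    choose π hπ using hd'
    exact ⟨π, edgeSet_eq_of_parent hF (by simpa using hLe) φ d π hπ⟩
  choose π hπ using hex
  -- The tree is recovered from the copy and the parents of the vertices outside it.
  let Y := Σ φ : W ↪ Fin v, ({y // y ∉ Set.range φ} → Fin v)
  let g : T → Y := fun x => ⟨x.2.toEmbedding, fun y => π x y⟩
  let k : Y → (W → Fin v) × (Fin v → Option (Fin v)) := fun y =>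
    (y.1, fun u => if h : u ∉ Set.range y.1 then some (y.2 ⟨u, h⟩) else none)
  have hg : Function.Injective g := by
    intro x x' h
    have h1 := congrArg k h
    obtain ⟨h2, h3⟩ := Prod.ext_iff.1 h1
    have h2 : (x.2 : W → Fin v) = x'.2 := h2
    have h4 : ∀ u ∈ (Set.range x.2)ᶜ, π x u = π x' u := by
      intro u hu
      have hu' : u ∉ Set.range x'.2 := by rw [← h2]; exact hu
      have h5 := congrFun h3 u
      have h6 : (k (g x)).2 u = some (π x u) := dif_pos hu
      have h7 : (k (g x')).2 u = some (π x' u) := dif_pos hu'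
      have h5 : (k (g x)).2 u = (k (g x')).2 u := h5
      rw [h6, h7] at h5
      exact Option.some_injective _ h5
    have h8 : x.1.1.edgeSet = x'.1.1.edgeSet := by
      rw [hπ x, hπ x', ← h2]
      congr 1
      exact Set.image_congr fun u hu => by rw [h4 u hu]
    obtain ⟨⟨L, hL⟩, φ⟩ := x
    obtain ⟨⟨L', hL'⟩, φ'⟩ := x'
    obtain rfl : L = L' := edgeSet_injective h8
    obtain rfl : φ = φ' := DFunLike.coe_injective h2
    rfl
  refine (Nat.card_le_card_of_injective g hg).trans (le_of_eq ?_)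
  rw [Nat.card_sigma]
  have h1 : ∀ φ : W ↪ Fin v, Nat.card ({y // y ∉ Set.range φ} → Fin v) =
      v ^ (v - Fintype.card W) := by
    intro φ
    rw [Nat.card_fun, Nat.card_fin, Nat.card_eq_fintype_card, Fintype.card_subtype_compl,
      Fintype.card_fin]
    congr 2
    exact Set.card_range_of_injective φ.injective
  simp only [h1, Finset.sum_const, Finset.card_univ, smul_eq_mul, Fintype.card_embedding_eq,
    Fintype.card_fin]

/-- The number of copies of `F` in connected components with `v` vertices, bounded by counting
copies of `F` in labelled trees. -/
theorem IsSparse.factorial_mul_card_copy_component_le [Finite V] [Fintype W] {n : ℕ} {p : ℝ}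
    {H : SimpleGraph V} (hs : IsSparse n p H) (hp : 0 ≤ p) (hp1 : p ≤ 1) (hnp : n * p ≤ 1 / 3)
    {F : SimpleGraph W} (hF : F.Connected) (v : ℕ) :
    (v.factorial : ℝ) * Nat.card (Σ c : {c : H.ConnectedComponent // Nat.card c = v},
        F.Copy c.1.toSimpleGraph) ≤
      6 * (n ^ v * p ^ (v - 1)) * (v.descFactorial (Fintype.card W) *
        v ^ (v - Fintype.card W)) := by
  classical
  let Tr := {L : SimpleGraph (Fin v) // L.Connected ∧ L.edgeSet.ncard + 1 = v}
  -- Double counting: each copy in a component of size `v` is taken with all `v!` labellings of that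
  -- component. A labelling carries the component to a labelled tree containing a copy of `F`,
  -- together with an isomorphism onto that tree.
  let A := Σ x : (Σ c : {c : H.ConnectedComponent // Nat.card c = v}, F.Copy c.1.toSimpleGraph),
    (x.1.1 ≃ Fin v)
  let B := Σ x : (Σ L : Tr, F.Copy L.1), (Σ c : H.ConnectedComponent, c.toSimpleGraph ≃g x.1.1)
  have hTr : ∀ (c : H.ConnectedComponent) (π : c ≃ Fin v),
      (c.toSimpleGraph.map π.toEmbedding).Connected ∧
        (c.toSimpleGraph.map π.toEmbedding).edgeSet.ncard + 1 = v := by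
    intro c π
    refine ⟨(Iso.map π c.toSimpleGraph).connected_iff.1 c.connected_toSimpleGraph, ?_⟩
    rw [ncard_edgeSet_map, hs.ncard_edgeSet_add_one hp hp1 hnp c.connected_toSimpleGraph c.copy,
      Nat.card_congr π, Nat.card_fin]
  let g : A → B := fun x => ⟨⟨⟨_, hTr x.1.1.1 x.2⟩, (Iso.map x.2 _).toCopy.comp x.1.2⟩,
    ⟨x.1.1.1, Iso.map x.2 _⟩⟩
  let k : B → H.ConnectedComponent × (W → V) × (Fin v → V) := fun y =>
    (y.2.1, fun w => (y.2.2.symm (y.1.2 w) : y.2.1), fun i => (y.2.2.symm i : y.2.1))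
  have hk : ∀ x : A, k (g x) = (x.1.1.1, fun w => (x.1.2 w : V), fun i => (x.2.symm i : V)) := by
    rintro ⟨⟨⟨c, hc⟩, φ⟩, π⟩
    refine Prod.ext rfl (Prod.ext ?_ rfl)
    funext w
    exact congrArg Subtype.val ((Iso.map π c.toSimpleGraph).symm_apply_apply (φ w))
  have hg : Function.Injective g := by
    intro x x' h
    have h1 : k (g x) = k (g x') := by rw [h]
    rw [hk, hk] at h1
    obtain ⟨⟨⟨c, hc⟩, φ⟩, π⟩ := x
    obtain ⟨⟨⟨c', hc'⟩, φ'⟩, π'⟩ := x'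
    obtain ⟨h2, h3⟩ := Prod.ext_iff.1 h1
    obtain ⟨h3, h4⟩ := Prod.ext_iff.1 h3
    obtain rfl : c = c' := h2
    obtain rfl : φ = φ' := DFunLike.coe_injective (funext fun w => Subtype.ext (congrFun h3 w))
    obtain rfl : π = π' := by
      rw [← Equiv.symm_bijective.injective.eq_iff]
      exact Equiv.ext fun i => Subtype.ext (congrFun h4 i)
    rfl
  have hA : Nat.card A = v.factorial * Nat.card (Σ c : {c : H.ConnectedComponent //
      Nat.card c = v}, F.Copy c.1.toSimpleGraph) := by
    have := Fintype.ofFinite (Σ c : {c : H.ConnectedComponent // Nat.card c = v},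
      F.Copy c.1.toSimpleGraph)
    rw [Nat.card_sigma]
    have h1 : ∀ x : (Σ c : {c : H.ConnectedComponent // Nat.card c = v},
        F.Copy c.1.toSimpleGraph), Nat.card (x.1.1 ≃ Fin v) = v.factorial := by
      rintro ⟨⟨c, hc⟩, φ⟩
      have e : c ≃ Fin v := (Finite.equivFin c).trans (finCongr hc)
      rw [Nat.card_congr (Equiv.equivCongr e (Equiv.refl (Fin v))), Nat.card_perm, Nat.card_fin]
    simp only [h1, Finset.sum_const, Finset.card_univ, smul_eq_mul, Nat.card_eq_fintype_card]
    rw [mul_comm]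
  have hB : (Nat.card B : ℝ) ≤ 6 * (n ^ v * p ^ (v - 1)) * Nat.card (Σ L : Tr, F.Copy L.1) := by
    have := Fintype.ofFinite (Σ L : Tr, F.Copy L.1)
    rw [Nat.card_sigma]
    push_cast
    have h1 : ∀ x : (Σ L : Tr, F.Copy L.1),
        (Nat.card (Σ c : H.ConnectedComponent, c.toSimpleGraph ≃g x.1.1) : ℝ) ≤
          6 * (n ^ v * p ^ (v - 1)) := by
      rintro ⟨⟨L, hL, hLe⟩, φ⟩
      have := hL.nonempty
      have h2 := hs.card_component_iso_le hp hp1 L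
      rw [Nat.card_fin, show L.edgeSet.ncard = v - 1 by omega] at h2
      exact h2
    refine (Finset.sum_le_sum fun x _ => h1 x).trans (le_of_eq ?_)
    rw [Finset.sum_const, Finset.card_univ, nsmul_eq_mul, Nat.card_eq_fintype_card, mul_comm]
  have h1 : (Nat.card A : ℝ) ≤ Nat.card B := by
    exact_mod_cast Nat.card_le_card_of_injective g hg
  rw [hA] at h1
  push_cast at h1
  refine h1.trans (hB.trans ?_)
  gcongr
  exact_mod_cast sum_card_copy_tree_le hF v

theorem IsSparse.card_copy_component_le [Finite V] [Fintype W] {n : ℕ} {p : ℝ}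
    {H : SimpleGraph V} (hs : IsSparse n p H) (hp : 0 ≤ p) (hp1 : p ≤ 1) (hnp : n * p ≤ 1 / 3)
    {F : SimpleGraph W} (hF : F.Connected) (v : ℕ) :
    (Nat.card (Σ c : {c : H.ConnectedComponent // Nat.card c = v},
        F.Copy c.1.toSimpleGraph) : ℝ) ≤
      if Fintype.card W ≤ v then 6 * Real.exp 1 * n * (Real.exp 1 * (n * p)) ^ (v - 1) else 0 := by
  have h := hs.factorial_mul_card_copy_component_le hp hp1 hnp hF v
  have hpos : (0 : ℝ) < v.factorial := by positivity
  have := hF.nonempty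
  have hW : 0 < Fintype.card W := Fintype.card_pos
  split_ifs with hv
  · refine le_of_mul_le_mul_left (h.trans ?_) hpos
    -- Dividing by `v!` leaves `v^(v - f) / (v - f)!` with `f = |W|`, which is at most `exp v`.
    have h1 := Real.pow_div_factorial_le_exp (v : ℝ) (by positivity) (v - Fintype.card W)
    rw [div_le_iff₀ (by positivity), ← Real.exp_one_pow] at h1
    have h2 : ((v - Fintype.card W).factorial : ℝ) * v.descFactorial (Fintype.card W) =
        v.factorial := by exact_mod_cast Nat.factorial_mul_descFactorial hv
    have h3 : v = v - 1 + 1 := by omega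
    calc 6 * (n ^ v * p ^ (v - 1)) * (v.descFactorial (Fintype.card W) *
          (v : ℝ) ^ (v - Fintype.card W))
        ≤ 6 * (n ^ v * p ^ (v - 1)) * (v.descFactorial (Fintype.card W) *
          (Real.exp 1 ^ v * (v - Fintype.card W).factorial)) := by gcongr
      _ = v.factorial * (6 * Real.exp 1 ^ v * n ^ v * p ^ (v - 1)) := by rw [← h2]; ring
      _ = v.factorial * (6 * Real.exp 1 ^ (v - 1 + 1) * n ^ (v - 1 + 1) * p ^ (v - 1)) := by
          rw [← h3]
      _ = _ := by rw [pow_succ, pow_succ, mul_pow, mul_pow]; ring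
  · rw [Nat.descFactorial_of_lt (by omega)] at h
    simp only [Nat.cast_zero, zero_mul, mul_zero] at h
    exact nonpos_of_mul_nonpos_right h hpos

/-- A copy of a connected graph lies in a single connected component. -/
theorem card_copy_le_sum_component [Finite V] [Finite W] {F : SimpleGraph W} (hF : F.Connected)
    (H : SimpleGraph V) :
    Nat.card (F.Copy H) ≤ ∑ v ∈ Finset.range (Nat.card V + 1),
      Nat.card (Σ c : {c : H.ConnectedComponent // Nat.card c = v},
        F.Copy c.1.toSimpleGraph) := by
  obtain ⟨w₀⟩ := hF.nonempty
  let comp : F.Copy H → H.ConnectedComponent := fun f => H.connectedComponentMk (f w₀)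
  have hmem : ∀ f w, f w ∈ (comp f).supp := fun f w =>
    ConnectedComponent.sound ((hF.preconnected w w₀).map f.toHom)
  let g : F.Copy H → Σ v : Fin (Nat.card V + 1), Σ c : {c : H.ConnectedComponent //
      Nat.card c = v}, F.Copy c.1.toSimpleGraph := fun f =>
    ⟨⟨Nat.card (comp f), Nat.lt_succ_of_le (Finite.card_subtype_le _)⟩, ⟨comp f, rfl⟩,
      ⟨⟨fun w => ⟨f w, hmem f w⟩, fun h => f.adj h⟩,
        fun w w' h => f.inj (congrArg Subtype.val h)⟩⟩
  have hg : Function.Injective g := fun f f' h =>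
    DFunLike.coe_injective (congrArg (fun x => fun w => (x.2.2 w : V)) h)
  refine (Nat.card_le_card_of_injective g hg).trans (le_of_eq ?_)
  rw [Nat.card_sigma]
  exact Fin.sum_univ_eq_sum_range (fun v => Nat.card (Σ c : {c : H.ConnectedComponent //
    Nat.card c = v}, F.Copy c.1.toSimpleGraph)) _

theorem sum_shifted_geometric_le {r : ℝ} (hr : 0 ≤ r) (hr1 : r ≤ 10 / 11) {f : ℕ} (hf : 0 < f)
    (N : ℕ) :
    ∑ v ∈ Finset.range N, (if f ≤ v then r ^ (v - 1) else 0) ≤ 11 * r ^ (f - 1) := by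
  have h1 : (Finset.range N).filter (fun v => f ≤ v) = Finset.Ico f N := by
    ext v; simp [and_comm]
  rw [← Finset.sum_filter, h1, Finset.sum_Ico_eq_sum_range]
  have h2 : ∀ i, r ^ (f + i - 1) = r ^ (f - 1) * r ^ i := fun i => by
    rw [← pow_add]; congr 1; omega
  simp only [h2]
  rw [← Finset.mul_sum, mul_comm 11]
  gcongr
  have h3 := geom_sum_mul_neg r (N - f)
  have h4 : 0 ≤ r ^ (N - f) := by positivity
  have h5 : 0 ≤ ∑ i ∈ Finset.range (N - f), r ^ i := by positivity
  nlinarith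

/-- Component sizes start at `|W|`, so the geometric sum is dominated by its first term, of exponent
`|W| - 1 = e(F)`. The ratio is at most `exp 1 / 3 < 10 / 11`. -/
theorem IsSparse.card_copy_le_of_connected [Finite V] [Finite W] {n : ℕ} {p : ℝ}
    {H : SimpleGraph V} (hs : IsSparse n p H) (hp : 0 ≤ p) (hp1 : p ≤ 1) (hnp : n * p ≤ 1 / 3)
    {F : SimpleGraph W} (hF : F.Connected) (hFe : F.edgeSet.ncard ≠ 0) :
    (Nat.card (F.Copy H) : ℝ) ≤ (540 * p) ^ F.edgeSet.ncard * n ^ Nat.card W := by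
  classical
  have := Fintype.ofFinite W
  rcases isEmpty_or_nonempty (F.Copy H) with h | ⟨⟨f⟩⟩
  · rw [Nat.card_of_isEmpty]; push_cast; positivity
  have he := hs.ncard_edgeSet_add_one hp hp1 hnp hF f
  have := hF.nonempty
  have hW : 0 < Fintype.card W := Fintype.card_pos
  have hexp := Real.exp_one_lt_d9
  have hexp0 : 0 < Real.exp 1 := Real.exp_pos 1
  have hnp0 : 0 ≤ n * p := by positivity
  have h1 : (Nat.card (F.Copy H) : ℝ) ≤ ∑ v ∈ Finset.range (Nat.card V + 1),
      6 * Real.exp 1 * n *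
        (if Fintype.card W ≤ v then (Real.exp 1 * (n * p)) ^ (v - 1) else 0) := by
    refine (Nat.cast_le.2 (card_copy_le_sum_component hF H)).trans ?_
    push_cast
    refine Finset.sum_le_sum fun v _ => ?_
    rw [mul_ite, mul_zero]
    exact hs.card_copy_component_le hp hp1 hnp hF v
  rw [← Finset.mul_sum] at h1
  have h2 := sum_shifted_geometric_le (r := Real.exp 1 * (n * p)) (by positivity)
    (by nlinarith) hW (Nat.card V + 1)
  rw [Nat.card_eq_fintype_card (α := W)] at he ⊢
  set e := F.edgeSet.ncard
  rw [show Fintype.card W - 1 = e by omega] at h2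
  rw [← he]
  calc (Nat.card (F.Copy H) : ℝ) ≤ _ := h1
    _ ≤ 6 * Real.exp 1 * n * (11 * (Real.exp 1 * (n * p)) ^ e) := by gcongr
    _ = (66 * Real.exp 1) * n * (Real.exp 1 * (n * p)) ^ e := by ring
    -- Here `66 * exp 1 < 180` and `exp 1 < 3`. Since `F` has an edge, 180 may then be raised to the
    -- power `e`, giving `180 * 3 = 540`.
    _ ≤ 180 * n * (3 * (n * p)) ^ e := by
        gcongr
        · linarith
        · linarith
    _ ≤ 180 ^ e * n * (3 * (n * p)) ^ e := by
        gcongr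
        exact le_self_pow₀ (by norm_num) hFe
    _ = _ := by
        rw [show (540 : ℝ) * p = 180 * (3 * p) by ring, pow_succ, mul_pow 180,
          show (3 : ℝ) * (n * p) = (3 * p) * n by ring, mul_pow _ (n : ℝ)]
        ring

theorem sum_card_component [Finite W] (F : SimpleGraph W) [Fintype F.ConnectedComponent] :
    ∑ c : F.ConnectedComponent, Nat.card c = Nat.card W := by
  rw [← Nat.card_sigma]
  refine Nat.card_eq_of_bijective (fun x => (x.2 : W)) ⟨?_, fun w => ⟨⟨_, ⟨w, rfl⟩⟩, rfl⟩⟩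
  rintro ⟨c, w, hw⟩ ⟨c', w', hw'⟩ h
  obtain rfl : w = w' := h
  obtain rfl : c = c' := hw.symm.trans hw'
  rfl

theorem sum_ncard_edgeSet_component [Finite W] (F : SimpleGraph W)
    [Fintype F.ConnectedComponent] :
    ∑ c : F.ConnectedComponent, c.toSimpleGraph.edgeSet.ncard = F.edgeSet.ncard := by
  simp only [← Nat.card_coe_set_eq]
  rw [← Nat.card_sigma]
  refine Nat.card_eq_of_bijective (fun x => (x.1.copy.mapEdgeSet x.2)) ⟨?_, ?_⟩
  · rintro ⟨c, e, he⟩ ⟨c', e', he'⟩ h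
    have h : Sym2.map Subtype.val e = Sym2.map Subtype.val e' := congrArg Subtype.val h
    obtain rfl : c = c' := by
      induction e with | _ a b
      have h1 : (a : W) ∈ Sym2.map Subtype.val e' := by rw [← h]; simp
      obtain ⟨a', -, ha'⟩ := Sym2.mem_map.1 h1
      have h2 : F.connectedComponentMk a' = c' := a'.2
      have h3 : F.connectedComponentMk a = c := a.2
      rw [← h2, ← h3, ha']
    obtain rfl := Sym2.map.injective Subtype.val_injective h
    rfl
  · rintro ⟨e, he⟩
    induction e with | _ a b
    have he : F.Adj a b := he
    refine ⟨⟨F.connectedComponentMk a, ⟨s(⟨a, rfl⟩, ⟨b, ?_⟩), ?_⟩⟩, rfl⟩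
    · exact (ConnectedComponent.connectedComponentMk_eq_of_adj he).symm
    · exact he

theorem card_copy_le_prod_component [Finite V] [Finite W] (F : SimpleGraph W)
    [Fintype F.ConnectedComponent] (H : SimpleGraph V) :
    Nat.card (F.Copy H) ≤ ∏ c : F.ConnectedComponent, Nat.card (c.toSimpleGraph.Copy H) := by
  rw [← Nat.card_pi]
  refine Nat.card_le_card_of_injective (fun f c => f.comp c.copy) fun f f' h => ?_
  ext w
  exact DFunLike.congr_fun (congrFun h (F.connectedComponentMk w)) ⟨w, rfl⟩

/-- The connected bound is multiplied over the components of `F`; each has an edge because no vertex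
of `F` is isolated. -/
theorem IsSparse.card_copy_le_of_mul_le [Finite V] [Finite W] {n : ℕ} {p : ℝ}
    {H : SimpleGraph V} (hs : IsSparse n p H) (hp : 0 ≤ p) (hp1 : p ≤ 1) (hnp : n * p ≤ 1 / 3)
    {F : SimpleGraph W} (hF : ∀ w, ∃ w', F.Adj w w') :
    (Nat.card (F.Copy H) : ℝ) ≤ (540 * p) ^ F.edgeSet.ncard * n ^ Nat.card W := by
  classical
  have := Fintype.ofFinite F.ConnectedComponent
  have hc : ∀ c : F.ConnectedComponent, (Nat.card (c.toSimpleGraph.Copy H) : ℝ) ≤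
      (540 * p) ^ c.toSimpleGraph.edgeSet.ncard * n ^ Nat.card c := by
    intro c
    refine hs.card_copy_le_of_connected hp hp1 hnp c.connected_toSimpleGraph ?_
    obtain ⟨w, hw⟩ := c.connected_toSimpleGraph.nonempty
    obtain ⟨w', hww⟩ := hF w
    have hw' : w' ∈ c := c.mem_supp_of_adj_mem_supp hw hww
    exact Set.ncard_ne_zero_of_mem (a := s(⟨w, hw⟩, ⟨w', hw'⟩)) hww
  calc (Nat.card (F.Copy H) : ℝ)
      ≤ ∏ c : F.ConnectedComponent, (Nat.card (c.toSimpleGraph.Copy H) : ℝ) := by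
        exact_mod_cast card_copy_le_prod_component F H
    _ ≤ ∏ c : F.ConnectedComponent,
          ((540 * p) ^ c.toSimpleGraph.edgeSet.ncard * (n : ℝ) ^ Nat.card c) :=
        Finset.prod_le_prod (fun _ _ => by positivity) fun c _ => hc c
    _ = _ := by
        rw [Finset.prod_mul_distrib, Finset.prod_pow_eq_pow_sum, Finset.prod_pow_eq_pow_sum,
          sum_card_component, sum_ncard_edgeSet_component]

theorem IsSparse.card_copy_le_descFactorial_of_mul_le [Finite V] [Finite W] {n : ℕ} {p : ℝ}
    {H : SimpleGraph V} (hs : IsSparse n p H) (hp : 0 ≤ p) (hp1 : p ≤ 1) (hnp : n * p ≤ 1 / 3)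
    (hV : Nat.card V ≤ n) (F : SimpleGraph W) :
    (Nat.card (F.Copy H) : ℝ) ≤
      n.descFactorial (Nat.card W) * (4860 * p) ^ F.edgeSet.ncard := by
  refine card_copy_le_of_induce_support F H hV ?_
  have hF := F.exists_adj_induce_support
  have hiso := card_le_two_mul_ncard_edgeSet hF
  generalize F.induce F.support = F' at *
  rcases card_copy_eq_zero_or_card_le F' H with h0 | hW
  · rw [h0]; push_cast; positivity
  have h1 := hs.card_copy_le_of_mul_le hp hp1 hnp hF
  have h2 := pow_le_three_pow_mul_descFactorial (hW.trans hV)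
  set v := Nat.card F.support
  set e := F'.edgeSet.ncard
  calc _ ≤ _ := h1
    _ ≤ (540 * p) ^ e * (3 ^ v * n.descFactorial v) := by gcongr
    -- Again `v ≤ 2e`, so the constant becomes `540 * 9 = 4860`.
    _ ≤ (540 * p) ^ e * (3 ^ (2 * e) * n.descFactorial v) := by
        gcongr
        norm_num
    _ = n.descFactorial v * ((540 * p) ^ e * (3 ^ 2) ^ e) := by rw [pow_mul]; ring
    _ = _ := by rw [← mul_pow]; congr 2; ring

theorem fractionalThreshold_lt_mul_of_lt [Fintype V] (n : ℕ) (H : SimpleGraph V)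
    (hn : Fintype.card V ≤ n) (hH : H ≠ ⊥) (hp : (graphicThreshold n H : ℝ) < 1 / (3 * (n : ℝ))) :
    (fractionalThreshold n H : ℝ) < 4861 * (graphicThreshold n H : ℝ) := by
  have hp0 := graphicThreshold_pos hH hn
  have hs := isSparse_of_mem_graphicFeasible (isLeast_graphicThreshold n H hn).1
  have hp1 : (graphicThreshold n H : ℝ) ≤ 1 := (graphicThreshold n H).2.2
  set p : ℝ := (graphicThreshold n H : ℝ)
  have hV := one_lt_card_of_ne_bot hH
  rw [Nat.card_eq_fintype_card] at hV
  have hn0 : (0 : ℝ) < n := by exact_mod_cast (by omega : 0 < n)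
  have hnp : n * p ≤ 1 / 3 := by
    rw [lt_div_iff₀ (by positivity)] at hp
    linarith
  have hle := fractionalThreshold_le_of_card_copy_le (q := 4860 * p) (by positivity) fun J =>
    hs.card_copy_le_descFactorial_of_mul_le hp0.le hp1 hnp
      (by rwa [Nat.card_eq_fintype_card]) J.coe
  linarith

end SimpleGraph

theorem theorem1p5 :
    (∃ K : ℝ, ∀ (n : ℕ) (V : Type u) [Fintype V] (H : SimpleGraph V),
      Fintype.card V ≤ n → H ≠ ⊥ →
        (fractionalThreshold n H : ℝ) < K * (graphicThreshold n H : ℝ) * (Real.logb 2 n) ^ 2) ∧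
    (∃ α : ℝ, 0 < α ∧ ∀ (n : ℕ) (V : Type u) [Fintype V] (H : SimpleGraph V),
      Fintype.card V ≤ n → H ≠ ⊥ →
        (graphicThreshold n H : ℝ) < 1 / (3 * (n : ℝ)) →
          (fractionalThreshold n H : ℝ) < α⁻¹ * (graphicThreshold n H : ℝ)) := by
  refine ⟨⟨5308416, fun n V _ H hn hH => SimpleGraph.fractionalThreshold_lt_mul_log_sq n H hn hH⟩,
    4861⁻¹, by norm_num, fun n V _ H hn hH hp => ?_⟩
  rw [inv_inv]
  exact SimpleGraph.fractionalThreshold_lt_mul_of_lt n H hn hH hp
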